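/- **Setting.** Let $K\neq 0$, $R\ge 0$, and if $K>0$ assume $R<\pi/(2\sqrt K)$. For $d\ge 0$ let $\mathcal N$ be the $d$-dimensional hyperbolic space of curvature $K$ (if $K<0$; the upper sheet of the hyperboloid $\langle p,p\rangle=1/K$ in Minkowski space $\mathbb R^{d,1}$) or the $d$-sphere of curvature $K$ (if $K>0$; the sphere $\langle p,p\rangle=1/K$ in $\mathbb R^{d+1}$). Let $x_0\in\mathcal N$ and $\mathcal M=\mathrm{Exp}_{x_0}(\bar B(0,R))$; if $K>0$ this lies in an open hemisphere. Let $F$ be a real function that is differentiable on $\mathrm{Exp}_{x_0}(B(0,R'))$ for some $R'>R$, and let $L>0$. $F$ is *$L$-smooth* on $\mathcal M$ if $F(y)\le F(x)+\langle\nabla F(x),\mathrm{Exp}_x^{-1}(y)\rangle+\frac L2 d(x,y)^2$ for all $x,y\in\mathcal M$, and *g-convex* on $\mathcal M$ if $F(y)\ge F(x)+\langle\nabla F(x),\mathrm{Exp}_x^{-1}(y)\rangle$ for all $x,y\in\mathcal M$. Let $h$ be the geodesic map centred at $x_0$ (gnomonic projection if $K>0$, Beltrami–Klein projection if $K<0$):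 after choosing an orthonormal frame $e:\mathbb R^d\to T_{x_0}\mathcal N$, $h^{-1}(u)=(x_0+e(u))/\sqrt{1+K\|u\|^2}$, for $1+K\|u\|^2>0$. Then $h(x_0)=0$ and $h(\mathcal M)$ is the closed Euclidean ball $\mathcal X$ of centre $0$ and radius $\tilde R=\tan(\sqrt K R)/\sqrt K$ if $K>0$, $\tilde R=\tanh(\sqrt{|K|}R)/\sqrt{|K|}$ if $K<0$. Put $f=F\circ h^{-1}$ and let $\Pi$ be the Euclidean projection onto $\mathcal X$. An *oracle query* at $u$ returns $f(u)$ and $\nabla f(u)$ (equivalently, the value and the gradient of $F$ at $h^{-1}(u)$). **Algorithm 1.** Inputs: $\gamma_n,\gamma_p\in(0,1]$, $\tilde L>0$, an accuracy $\epsilon>0$ and a number $t$ of iterations. Put $a_i=i\gamma_n^2\gamma_p/(2\tilde L)$, $A_i=a_1+\dots+a_i$, and start from $\tilde x_0=\tilde z_0=0$. For $i=0,\dots,t-1$ and a parameter $\lambda$ put $$\chi^\lambda=(1-\lambda)\tilde x_i+\lambda\Pi(\tilde z_i),\quad \zeta^\lambda=\tilde z_i-\tfrac{a_{i+1}}{\gamma_n}\nabla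 f(\chi^\lambda),\quad \tilde x^\lambda=(1-\lambda)\tilde x_i+\lambda\Pi(\zeta^\lambda),\quad s(\lambda)=\langle\nabla f(\tilde x^\lambda),\tilde x^\lambda-\tilde x_i\rangle,$$ and let $\lambda(\gamma)=\dfrac{a_{i+1}/\gamma_n}{A_i\gamma+a_{i+1}/\gamma_n}$. Say that $\lambda=\lambda(\gamma)$ is *accepted* if $$f(\tilde x^\lambda)-f(\tilde x_i)-\gamma\, s(\lambda)\le\frac{A_t\,\epsilon}{2(t-1)A_i},$$ where for $i=0$ (as $A_0=0$) the right-hand side is read as $+\infty$. The binary line search tries $\lambda(1/\gamma_n)$, then $\lambda(\gamma_p)$, and takes the first one that is accepted. If neither is, it sets $l=\lambda(1/\gamma_n)$, $r=\lambda(\gamma_p)$ and tests $\lambda=(l+r)/2$ repeatedly, until this $\lambda$ is accepted; after a failed test it replaces $l$ by $\lambda$ if $s(\lambda)<0$, and $r$ by $\lambda$ otherwise. With the $\lambda$ that was found, put $\tilde x_{i+1}=\tilde x^\lambda$ and $\tilde z_{i+1}=\tilde z_i-\frac{a_{i+1}}{\gamma_n}\nabla f(\tilde x_{i+1})$. After $t$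 iterations return $x_t=h^{-1}(\tilde x_t)$. **Theorem (g-Convex Acceleration).** For all $K$ and $R$ as above there are constants $\gamma_n,\gamma_p\in(0,1]$, $c>0$, $C>0$ and a function $T:\mathbb R\times\mathbb R\to\mathbb N$, all depending on $K$ and $R$ only, such that the following holds for every dimension $d$, every $x_0$ and every frame $e$, all $L>0$ and $\epsilon>0$, and every $F$ as above that is $L$-smooth and g-convex on $\mathcal M$ and has a critical point $x^*\in\mathcal M$, $\nabla F(x^*)=0$. Algorithm 1, run with $\gamma_n$, $\gamma_p$, $\tilde L=cL$, accuracy $\epsilon$ and $t=T(L,\epsilon)$ iterations, terminates and returns a point $x_t\in\mathcal M$ with $$F(x_t)-F(x^*)\le\epsilon,$$ and it makes at most $C\sqrt{L/\epsilon}\,\log(2+L/\epsilon)$ oracle queries, that is, $\tilde O(\sqrt{L/\epsilon})$ queries. -/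

import Mathlib

open scoped RealInnerProductSpace Topology

noncomputable section

namespace GConvexAcceleration

/-! ### Spaces of constant curvature `K ≠ 0`

The sphere of radius `1/√K` in Euclidean space (`K > 0`), and the upper sheet of the hyperboloid
in Minkowski space (`K < 0`). -/

/-- The Euclidean space `ℝ^d`. -/
abbrev Euc (d : ℕ) : Type := EuclideanSpace ℝ (Fin d)

/-- The vector space `ℝ × ℝ^d` in which the model space of dimension `d` is embedded. -/
abbrev Amb (d : ℕ) : Type := ℝ × Euc d

/-- The ambient bilinear form: Euclidean for `K > 0`, Minkowski for `K < 0`. Its restriction to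
the tangent spaces of the model space is the Riemannian metric. -/
def form {d : ℕ} (K : ℝ) (p q : Amb d) : ℝ := Real.sign K * (p.1 * q.1) + ⟪p.2, q.2⟫

/-- The simply connected complete space of constant curvature `K`: the sphere of radius `1/√K`
if `K > 0`, and the upper sheet of the hyperboloid `⟨p, p⟩ = -1/|K|` if `K < 0`. -/
def modelSpace (K : ℝ) (d : ℕ) : Set (Amb d) :=
  {p | form K p p = 1 / K ∧ (K < 0 → 0 < p.1)}

/-- The tangent space at `p`, as a subspace of the ambient space. -/
def tangent {d : ℕ} (K : ℝ) (p : Amb d) : Set (Amb d) := {v | form K p v = 0}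

/-- The Riemannian norm of a tangent vector. -/
def tnorm {d : ℕ} (K : ℝ) (v : Amb d) : ℝ := Real.sqrt (form K v v)

/-- The cosine of curvature `K`. -/
def cosK (K r : ℝ) : ℝ :=
  if 0 < K then Real.cos (Real.sqrt K * r) else Real.cosh (Real.sqrt (-K) * r)

/-- The sine of curvature `K`. -/
def sinK (K r : ℝ) : ℝ :=
  if 0 < K then Real.sin (Real.sqrt K * r) / Real.sqrt K
  else Real.sinh (Real.sqrt (-K) * r) / Real.sqrt (-K)

/-- The exponential map `Exp_p(v)`, for `v` tangent at `p`: the time one point of the geodesic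
starting at `p` with velocity `v`. (For `v = 0` the second summand vanishes.) -/
def expMap {d : ℕ} (K : ℝ) (p v : Amb d) : Amb d :=
  cosK K (tnorm K v) • p + (sinK K (tnorm K v) / tnorm K v) • v

/-- `v = Exp_x⁻¹(y)`: `v` is the initial velocity of the minimizing geodesic from `x` to `y`
(in the sphere, geodesics shorter than `π/√K` are the unique minimizing ones). In this case
`tnorm K v` is the distance `d(x, y)`. -/
def IsExpInv {d : ℕ} (K : ℝ) (x y v : Amb d) : Prop :=
  v ∈ tangent K x ∧ expMap K x v = y ∧ (0 < K → tnorm K v < Real.pi / Real.sqrt K)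

/-- `Exp_{x₀}(B̄(0, R))`. -/
def closedGeodBall {d : ℕ} (K : ℝ) (x₀ : Amb d) (R : ℝ) : Set (Amb d) :=
  {p | ∃ v ∈ tangent K x₀, tnorm K v ≤ R ∧ expMap K x₀ v = p}

/-- `Exp_{x₀}(B(0, R))`. -/
def openGeodBall {d : ℕ} (K : ℝ) (x₀ : Amb d) (R : ℝ) : Set (Amb d) :=
  {p | ∃ v ∈ tangent K x₀, tnorm K v < R ∧ expMap K x₀ v = p}

/-! ### Gradients, smoothness, geodesic convexity

A function on (part of) the model space is represented by a function on the ambient space, of which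
only the values on the model space are ever used. -/

/-- `F` is differentiable at the point `p` of the model space, with Riemannian gradient `g`:
`F(Exp_p(v)) = F(p) + ⟨g, v⟩ + o(‖v‖)` as `v → 0` in the tangent space at `p`. -/
def HasRiemGradAt {d : ℕ} (K : ℝ) (F : Amb d → ℝ) (p g : Amb d) : Prop :=
  g ∈ tangent K p ∧
    (fun v : Amb d => F (expMap K p v) - F p - form K g v)
      =o[𝓝[tangent K p] (0 : Amb d)] (fun v : Amb d => tnorm K v)

/-- Differentiability at a point of the model space. -/
def RiemDifferentiableAt {d : ℕ} (K : ℝ) (F : Amb d → ℝ) (p : Amb d) : Prop :=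
  ∃ g, HasRiemGradAt K F p g

open Classical in
/-- The Riemannian gradient `∇F(p)` (zero if `F` is not differentiable at `p`). -/
def riemGrad {d : ℕ} (K : ℝ) (F : Amb d → ℝ) (p : Amb d) : Amb d :=
  if h : ∃ g, HasRiemGradAt K F p g then h.choose else 0

/-- `F` is `L`-smooth on `A`: `F(y) ≤ F(x) + ⟨∇F(x), Exp_x⁻¹(y)⟩ + (L/2) d(x,y)²` on `A`. -/
def SmoothOn {d : ℕ} (K L : ℝ) (F : Amb d → ℝ) (A : Set (Amb d)) : Prop :=
  ∀ x ∈ A, ∀ y ∈ A, ∀ v, IsExpInv K x y v →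
    F y ≤ F x + form K (riemGrad K F x) v + L / 2 * tnorm K v ^ 2

/-- `F` is geodesically convex on `A`: `F(y) ≥ F(x) + ⟨∇F(x), Exp_x⁻¹(y)⟩` on `A`. -/
def GConvexOn {d : ℕ} (K : ℝ) (F : Amb d → ℝ) (A : Set (Amb d)) : Prop :=
  ∀ x ∈ A, ∀ y ∈ A, ∀ v, IsExpInv K x y v →
    F x + form K (riemGrad K F x) v ≤ F y

/-! ### The geodesic map -/

/-- `e` is a linear isometry of `ℝ^d` onto the tangent space at `x₀`, that is, an orthonormal
frame at `x₀` (surjectivity is automatic, both spaces having dimension `d`). -/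
def IsFrame {d : ℕ} (K : ℝ) (x₀ : Amb d) (e : Euc d →ₗ[ℝ] Amb d) : Prop :=
  (∀ u, e u ∈ tangent K x₀) ∧ ∀ u w, form K (e u) (e w) = ⟪u, w⟫

/-- The inverse `h⁻¹` of the geodesic map centred at `x₀`, in the coordinates given by `e`. The map
`h` is the central projection of the model space onto the tangent hyperplane `x₀ + T_{x₀}`, that
is, the gnomonic projection if `K > 0` and the Beltrami-Klein projection if `K < 0`. It is defined
where `1 + K ‖u‖² > 0`, and `h⁻¹(0) = x₀`. -/
def geodInv {d : ℕ} (K : ℝ) (x₀ : Amb d) (e : Euc d →ₗ[ℝ] Amb d) (u : Euc d) : Amb d :=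
  (Real.sqrt (1 + K * ‖u‖ ^ 2))⁻¹ • (x₀ + e u)

/-- The radius `R̃` of the Euclidean ball `h(Exp_{x₀}(B̄(0, R)))`. -/
def ballRadius (K R : ℝ) : ℝ :=
  if 0 < K then Real.tan (Real.sqrt K * R) / Real.sqrt K
  else Real.tanh (Real.sqrt (-K) * R) / Real.sqrt (-K)

/-! ### The algorithm -/

/-- The Euclidean projection onto the closed ball of radius `r` centred at `0`. -/
def proj {d : ℕ} (r : ℝ) (z : Euc d) : Euc d := if ‖z‖ ≤ r then z else (r / ‖z‖) • z

/-- The input of the algorithm: first-order oracle access to a function `f` on a Euclidean ball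
(`val` returns the value and `grad` the gradient at the queried point), the radius of the ball,
the constants `γₙ`, `γₚ` and `L̃`, the accuracy `ε` and the number of iterations `t`. -/
structure Input (d : ℕ) where
  val : Euc d → ℝ
  grad : Euc d → Euc d
  radius : ℝ
  γn : ℝ
  γp : ℝ
  Lt : ℝ
  ε : ℝ
  t : ℕ

variable {d : ℕ}

/-- The learning rate `a_i = i γₙ² γₚ / (2 L̃)`. -/
def rate (P : Input d) (i : ℕ) : ℝ := (i : ℝ) * P.γn ^ 2 * P.γp / (2 * P.Lt)

/-- The accumulated learning rate `A_i = a_1 + ⋯ + a_i`. -/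
def accRate (P : Input d) (i : ℕ) : ℝ := ∑ j ∈ Finset.range i, rate P (j + 1)

/-- `Γ_i⁻¹(γ) = (a_{i+1}/γₙ) / (A_i γ + a_{i+1}/γₙ)`. -/
def weightOf (P : Input d) (i : ℕ) (γ : ℝ) : ℝ :=
  (rate P (i + 1) / P.γn) / (accRate P i * γ + rate P (i + 1) / P.γn)

/-- `Γ_i(lam)`, the number `γ` with `weightOf P i γ = lam` (for `i ≥ 1`). -/
def gammaOf (P : Input d) (i : ℕ) (lam : ℝ) : ℝ :=
  (rate P (i + 1) / P.γn) * (1 - lam) / (accRate P i * lam)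

/-- The point `χ_i`. -/
def chi (P : Input d) (lam : ℝ) (x z : Euc d) : Euc d :=
  (1 - lam) • x + lam • proj P.radius z

/-- The point `ζ_i`. -/
def zeta (P : Input d) (i : ℕ) (lam : ℝ) (x z : Euc d) : Euc d :=
  z - (rate P (i + 1) / P.γn) • P.grad (chi P lam x z)

/-- The point `x_{i+1}` obtained from `x = x_i` and `z = z_i` with the parameter `lam`. -/
def next (P : Input d) (i : ℕ) (lam : ℝ) (x z : Euc d) : Euc d :=
  (1 - lam) • x + lam • proj P.radius (zeta P i lam x z)

/-- The inner product `⟨∇f(x_{i+1}), x_{i+1} - x_i⟩`. -/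
def slope (P : Input d) (i : ℕ) (lam : ℝ) (x z : Euc d) : ℝ :=
  ⟪P.grad (next P i lam x z), next P i lam x z - x⟫

/-- The function `G_i(lam) = -Γ_i(lam) ⟨∇f(x_{i+1}), x_{i+1} - x_i⟩ + f(x_{i+1}) - f(x_i)`. -/
def gapFun (P : Input d) (i : ℕ) (lam : ℝ) (x z : Euc d) : ℝ :=
  -gammaOf P i lam * slope P i lam x z + (P.val (next P i lam x z) - P.val x)

/-- The test `G_i(lam) ≤ A_t ε / (2 (t - 1) A_i)` of the line search, with the denominator cleared:
for `i = 0`, where `A_0 = 0` and the right-hand side is infinite, the test succeeds. -/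
def Accepts (P : Input d) (i : ℕ) (lam : ℝ) (x z : Euc d) : Prop :=
  2 * ((P.t : ℝ) - 1) * accRate P i * gapFun P i lam x z ≤ accRate P P.t * P.ε

/-- `Bisect P i x z l r lam q`: the loop of the line search, entered with the interval `[l, r]`,
terminates and returns `lam`, after `q` oracle queries. Every evaluation of the test costs three
queries: the gradient at `χ_i`, the value and gradient at `x_{i+1}`, and the value at `x_i`. -/
inductive Bisect (P : Input d) (i : ℕ) (x z : Euc d) : ℝ → ℝ → ℝ → ℕ → Prop
  | found (l r : ℝ) (h : Accepts P i ((l + r) / 2) x z) :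
      Bisect P i x z l r ((l + r) / 2) 3
  | right (l r lam : ℝ) (q : ℕ) (h : ¬ Accepts P i ((l + r) / 2) x z)
      (hs : slope P i ((l + r) / 2) x z < 0)
      (hb : Bisect P i x z ((l + r) / 2) r lam q) : Bisect P i x z l r lam (q + 3)
  | left (l r lam : ℝ) (q : ℕ) (h : ¬ Accepts P i ((l + r) / 2) x z)
      (hs : 0 ≤ slope P i ((l + r) / 2) x z)
      (hb : Bisect P i x z l ((l + r) / 2) lam q) : Bisect P i x z l r lam (q + 3)

/-- `LineSearch P i x z lam q`: the binary line search at iteration `i` terminates and returns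
`lam`, after `q` oracle queries. -/
inductive LineSearch (P : Input d) (i : ℕ) (x z : Euc d) : ℝ → ℕ → Prop
  | first (h : Accepts P i (weightOf P i (1 / P.γn)) x z) :
      LineSearch P i x z (weightOf P i (1 / P.γn)) 3
  | second (h₁ : ¬ Accepts P i (weightOf P i (1 / P.γn)) x z)
      (h₂ : Accepts P i (weightOf P i P.γp) x z) :
      LineSearch P i x z (weightOf P i P.γp) 6
  | loop (lam : ℝ) (q : ℕ) (h₁ : ¬ Accepts P i (weightOf P i (1 / P.γn)) x z)
      (h₂ : ¬ Accepts P i (weightOf P i P.γp) x z)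
      (hb : Bisect P i x z (weightOf P i (1 / P.γn)) (weightOf P i P.γp) lam q) :
      LineSearch P i x z lam (q + 6)

/-- `Run P i x z q`: the first `i` iterations of the algorithm terminate, and lead to the points
`x_i = x` and `z_i = z`, after `q` oracle queries. An iteration consists of the line search and of
an update, which makes two further queries (at `χ_i` and at `x_{i+1}`). -/
inductive Run (P : Input d) : ℕ → Euc d → Euc d → ℕ → Prop
  | init : Run P 0 0 0 0
  | step (i : ℕ) (x z : Euc d) (q : ℕ) (lam : ℝ) (n : ℕ) (h : Run P i x z q)
      (hs : LineSearch P i x z lam n) :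
      Run P (i + 1) (next P i lam x z)
        (z - (rate P (i + 1) / P.γn) • P.grad (next P i lam x z)) (q + n + 2)

/-- `Returns P x q`: the algorithm terminates on the input `P`, makes `q` oracle queries, and returns
the point `x = x_t`. -/
def Returns (P : Input d) (x : Euc d) (q : ℕ) : Prop := ∃ z, Run P P.t x z q

/-- The input on which the algorithm is run in order to minimize `F` on `Exp_{x₀}(B̄(0, R))`: the
function is `f = F ∘ h⁻¹`, so that a query of `f` at `u` is a query of `F` at `h⁻¹(u)`. -/
def inputFor (K R : ℝ) (x₀ : Amb d) (e : Euc d →ₗ[ℝ] Amb d) (F : Amb d → ℝ)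
    (γn γp Lt ε : ℝ) (t : ℕ) : Input d where
  val := fun u => F (geodInv K x₀ e u)
  grad := gradient (fun u => F (geodInv K x₀ e u))
  radius := ballRadius K R
  γn := γn
  γp := γp
  Lt := Lt
  ε := ε
  t := t

end GConvexAcceleration

end

open GConvexAcceleration

/-!
The geodesic map `h` sends geodesics to line segments, so that for `x = h⁻¹(u)` and `y = h⁻¹(w)` the
velocity `Exp_x⁻¹(y)` is a positive multiple `θ` of the image of `w - u` under the differential of
`h⁻¹`. On a ball, `θ` is bounded above and away from `0`, `|θ - 1| = O(‖w - u‖)`, and `d(x, y)` is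
`O(‖w - u‖)`, with constants that depend on the curvature and the radius only (`exists_isExpInv`;
for `K > 0` this uses that the ball stays away from antipodal points). This gives two things.

First, `f = F ∘ h⁻¹` is tilted-convex: `f(u) + θ ⟨∇f(u), w - u⟩ ≤ f(w)` for some
`θ ∈ [γₚ, 1/γₙ]`. Secondly, the gradient of `f` is `O(L)` by the existence of a critical point, so the
error `(θ - 1) ⟨∇f(u), w - u⟩` is `O(L ‖w - u‖²)`. Hence `f` is within `O(L ‖w - u‖²)` of its
linearizations, and the gradient of `f` is `O(L)`-Lipschitz on the closed ball
(`norm_sub_le_of_abs_sub_linearization_le`).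

For the algorithm, let `ψ*` be the conjugate of `‖x‖² / 2` restricted to the ball. The extragradient
inequality `dualPotential_sub_le` and tilted convexity show that
`A_i (f(x_i) - f(x*)) + ψ*(z_i) - ⟨z_i, x*⟩` increases in an iteration by at most `A_i G_i(lam)`
(`potential_succ_le`). The line search makes the sum of these defects at most `A_t ε / 2`, and
`ψ*(z) - ⟨z, x*⟩ ≥ -‖x*‖² / 2` then gives the accuracy `ε` as soon as `A_t ε ≥ r²`, where `r` is the
radius of the ball; since `A_t` is of the order of `t² / L`, this takes `O(√(L / ε))` iterations.

The line search terminates quickly (`exists_bisect`): tilted convexity forces `f(x^lam) ≤ f(x_i)` at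
the left end of the interval, while a failed test forces `f(x^lam) > f(x_i) + ε / (2 (t - 1))` at the
right end. As `f(x^lam)` is Lipschitz in `lam`, the interval cannot shrink below a length whose
inverse is polynomial in `L / ε`, so a test succeeds after `O(log (2 + L / ε))` bisections. If `L / ε`
is small, the starting point is already good enough and no iteration is made.
-/

namespace GConvexAcceleration

variable {d : ℕ}

/-! ### The projection onto a ball and its dual potential -/

theorem norm_proj_le {r : ℝ} (hr : 0 ≤ r) (z : Euc d) : ‖proj r z‖ ≤ r := by
  unfold proj
  split_ifs with h
  · exact h
  · have hz : 0 < ‖z‖ := hr.trans_lt (not_le.mp h)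
    rw [norm_smul, Real.norm_of_nonneg (by positivity), div_mul_cancel₀ _ hz.ne']

/-- The variational inequality that characterizes the projection. -/
theorem inner_sub_proj_nonpos {r : ℝ} (hr : 0 ≤ r) (z : Euc d) {y : Euc d} (hy : ‖y‖ ≤ r) :
    ⟪z - proj r z, y - proj r z⟫ ≤ 0 := by
  unfold proj
  split_ifs with h
  · simp
  · have hz : 0 < ‖z‖ := hr.trans_lt (not_le.mp h)
    have h1 : z - (r / ‖z‖) • z = (1 - r / ‖z‖) • z := by rw [sub_smul, one_smul]
    have h2 : ⟪z, y⟫ ≤ ‖z‖ * r :=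
      (real_inner_le_norm z y).trans (mul_le_mul_of_nonneg_left hy hz.le)
    have h3 : r / ‖z‖ * ‖z‖ ^ 2 = r * ‖z‖ := by field_simp
    rw [h1, real_inner_smul_left, inner_sub_right, real_inner_smul_right,
      real_inner_self_eq_norm_sq, h3]
    have h4 : r / ‖z‖ ≤ 1 := (div_le_one hz).mpr (not_le.mp h).le
    exact mul_nonpos_of_nonneg_of_nonpos (by linarith) (by linarith)

theorem norm_proj_sub_le {r : ℝ} (hr : 0 ≤ r) (z w : Euc d) :
    ‖proj r z - proj r w‖ ≤ ‖z - w‖ := by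
  have h1 := inner_sub_proj_nonpos hr z (norm_proj_le hr w)
  have h2 := inner_sub_proj_nonpos hr w (norm_proj_le hr z)
  have h3 : ‖proj r z - proj r w‖ ^ 2 ≤ ⟪z - w, proj r z - proj r w⟫ := by
    rw [← real_inner_self_eq_norm_sq]
    simp only [inner_sub_left, inner_sub_right] at h1 h2 ⊢
    linarith [real_inner_comm (proj r z) (proj r w)]
  have h4 := h3.trans (real_inner_le_norm _ _)
  by_contra! h
  nlinarith [norm_nonneg (z - w), norm_nonneg (proj r z - proj r w)]

/-- The convex conjugate of `‖x‖² / 2` restricted to the ball of radius `r`, that is,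
`max_{‖x‖ ≤ r} ⟨z, x⟩ - ‖x‖² / 2`; the maximum is attained at the projection of `z`. -/
noncomputable def dualPotential (r : ℝ) (z : Euc d) : ℝ := ⟪z, proj r z⟫ - ‖proj r z‖ ^ 2 / 2

/-- The strong form of the Fenchel-Young inequality for `dualPotential`. -/
theorem le_dualPotential {r : ℝ} (hr : 0 ≤ r) (z : Euc d) {y : Euc d} (hy : ‖y‖ ≤ r) :
    ⟪z, y⟫ - ‖y‖ ^ 2 / 2 + ‖y - proj r z‖ ^ 2 / 2 ≤ dualPotential r z := by
  have h := inner_sub_proj_nonpos hr z hy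
  unfold dualPotential
  rw [norm_sub_sq_real]
  rw [inner_sub_left, inner_sub_right, inner_sub_right, real_inner_self_eq_norm_sq] at h
  linarith [real_inner_comm y (proj r z)]

/-- One extragradient step in the dual space. The gradient `g'` at the predicted point determines
the point `q`, and the loss incurred by `q` along the true gradient `g` is paid for by the decrease
of the potential, provided that `g'` approximates `g` well enough. -/
theorem dualPotential_sub_le {r : ℝ} (hr : 0 ≤ r) (z g g' : Euc d)
    (h : ‖g - g'‖ ≤ ‖proj r (z - g') - proj r z‖) :
    dualPotential r (z - g) ≤ dualPotential r z - ⟪g, proj r (z - g')⟫ := by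
  have h1 := le_dualPotential hr z (norm_proj_le hr (z - g'))
  have h2 := le_dualPotential hr (z - g') (norm_proj_le hr (z - g))
  have h3 : ⟪g - g', proj r (z - g') - proj r (z - g)⟫
      ≤ ‖proj r (z - g') - proj r z‖ * ‖proj r (z - g') - proj r (z - g)‖ :=
    (real_inner_le_norm _ _).trans (mul_le_mul_of_nonneg_right h (norm_nonneg _))
  rw [norm_sub_rev (proj r (z - g)) (proj r (z - g'))] at h2
  unfold dualPotential at *
  simp only [inner_sub_left, inner_sub_right] at *
  nlinarith [sq_nonneg (‖proj r (z - g') - proj r z‖ - ‖proj r (z - g') - proj r (z - g)‖)]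

/-! ### One iteration -/

/-- The properties of the objective `f` on the ball that the analysis of the algorithm uses: up to
a factor in `[γₚ, 1/γₙ]` in front of the linear term it lies above its linearizations
(tilted convexity), its gradient is `L̃`-Lipschitz, it is `G`-Lipschitz, and `xs` is a minimizer. -/
structure TiltedConvex (P : Input d) (G : ℝ) (xs : Euc d) : Prop where
  radius_nonneg : 0 ≤ P.radius
  γn_pos : 0 < P.γn
  γn_le : P.γn ≤ 1
  γp_pos : 0 < P.γp
  γp_le : P.γp ≤ 1
  Lt_pos : 0 < P.Lt
  ε_pos : 0 < P.ε
  tilted : ∀ x y : Euc d, ‖x‖ ≤ P.radius → ‖y‖ ≤ P.radius →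
    ∃ θ, P.γp ≤ θ ∧ θ ≤ 1 / P.γn ∧ P.val x + θ * ⟪P.grad x, y - x⟫ ≤ P.val y
  grad_lipschitz : ∀ x y : Euc d, ‖x‖ ≤ P.radius → ‖y‖ ≤ P.radius →
    ‖P.grad x - P.grad y‖ ≤ P.Lt * ‖x - y‖
  val_lipschitz : ∀ x y : Euc d, ‖x‖ ≤ P.radius → ‖y‖ ≤ P.radius →
    P.val x - P.val y ≤ G * ‖x - y‖
  minimizer_mem : ‖xs‖ ≤ P.radius
  minimizer_le : ∀ x : Euc d, ‖x‖ ≤ P.radius → P.val xs ≤ P.val x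

theorem norm_convexCombination_le {r lam : ℝ} {x y : Euc d} (h0 : 0 ≤ lam) (h1 : lam ≤ 1)
    (hx : ‖x‖ ≤ r) (hy : ‖y‖ ≤ r) : ‖(1 - lam) • x + lam • y‖ ≤ r := by
  refine (norm_add_le _ _).trans ?_
  rw [norm_smul, norm_smul, Real.norm_of_nonneg h0, Real.norm_of_nonneg (by linarith)]
  nlinarith

theorem accRate_succ (P : Input d) (i : ℕ) :
    accRate P (i + 1) = accRate P i + rate P (i + 1) := by
  simp [accRate, Finset.sum_range_succ]

theorem accRate_eq (P : Input d) (i : ℕ) :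
    accRate P i = (i : ℝ) * (i + 1) * P.γn ^ 2 * P.γp / (4 * P.Lt) := by
  induction i with
  | zero => simp [accRate]
  | succ k ih =>
    rw [accRate_succ, ih, rate]
    push_cast
    rcases eq_or_ne P.Lt 0 with h | h
    · simp [h]
    · field_simp
      ring

namespace TiltedConvex

variable {P : Input d} {G : ℝ} {xs : Euc d} (H : TiltedConvex P G xs)
include H

theorem rate_pos (i : ℕ) : 0 < rate P (i + 1) := by
  have := H.γn_pos; have := H.γp_pos; have := H.Lt_pos
  unfold rate; positivity

theorem accRate_nonneg (i : ℕ) : 0 ≤ accRate P i := by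
  have := H.γn_pos; have := H.γp_pos; have := H.Lt_pos
  rw [accRate_eq]; positivity

theorem accRate_pos {i : ℕ} (hi : 0 < i) : 0 < accRate P i := by
  have := H.γn_pos; have := H.γp_pos; have := H.Lt_pos
  rw [accRate_eq]; positivity

theorem accRate_mono {i j : ℕ} (hij : i ≤ j) : accRate P i ≤ accRate P j := by
  induction hij with
  | refl => exact le_rfl
  | step _ ih => exact ih.trans (by rw [accRate_succ]; linarith [H.rate_pos (by assumption)])

theorem step_pos (i : ℕ) : 0 < rate P (i + 1) / P.γn := div_pos (H.rate_pos i) H.γn_pos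

theorem weightOf_pos (i : ℕ) {γ : ℝ} (hγ : 0 < γ) : 0 < weightOf P i γ := by
  have h1 := H.step_pos i; have h2 := H.accRate_nonneg i
  unfold weightOf; positivity

theorem weightOf_le_one (i : ℕ) {γ : ℝ} (hγ : 0 < γ) : weightOf P i γ ≤ 1 := by
  have h1 := H.step_pos i; have h2 := H.accRate_nonneg i
  unfold weightOf
  rw [div_le_one (by positivity)]
  nlinarith [mul_nonneg h2 hγ.le]

theorem weightOf_anti (i : ℕ) {γ γ' : ℝ} (hγ : 0 < γ) (h : γ ≤ γ') :
    weightOf P i γ' ≤ weightOf P i γ := by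
  have h1 := H.step_pos i; have h2 := H.accRate_nonneg i
  unfold weightOf
  gcongr

theorem γp_le_inv : P.γp ≤ 1 / P.γn :=
  H.γp_le.trans ((one_le_div H.γn_pos).mpr H.γn_le)

theorem gammaOf_weightOf {i : ℕ} (hi : 0 < i) {γ : ℝ} (hγ : 0 < γ) :
    gammaOf P i (weightOf P i γ) = γ := by
  have h1 := H.step_pos i; have h2 := H.accRate_pos hi
  unfold gammaOf weightOf
  generalize rate P (i + 1) / P.γn = α at *
  have h3 : 0 < accRate P i * γ + α := by positivity
  field_simp
  ring

/-- The choice of the learning rates makes every admissible step short enough for the extragradient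
step. -/
theorem step_mul_le {i : ℕ} {lam : ℝ} (hlam : lam ≤ weightOf P i P.γp) :
    rate P (i + 1) / P.γn * lam * P.Lt ≤ 1 := by
  have h1 := H.step_pos i; have h2 := H.accRate_nonneg i
  have hn := H.γn_pos; have hp := H.γp_pos; have hL := H.Lt_pos
  have hn1 := H.γn_le; have hp1 := H.γp_le
  calc rate P (i + 1) / P.γn * lam * P.Lt
      ≤ rate P (i + 1) / P.γn * weightOf P i P.γp * P.Lt := by gcongr
    _ = ((i + 1) * (P.γn * P.γp)) / (i * (P.γn * P.γp) + 2) := by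
        unfold weightOf
        rw [accRate_eq, rate]
        push_cast
        field_simp
        ring
    _ ≤ 1 := by
        have h3 : P.γn * P.γp ≤ 1 := mul_le_one₀ hn1 hp.le hp1
        rw [div_le_one (by positivity)]
        nlinarith

theorem norm_next_le (i : ℕ) {lam : ℝ} (h0 : 0 ≤ lam) (h1 : lam ≤ 1) {x : Euc d}
    (hx : ‖x‖ ≤ P.radius) (z : Euc d) : ‖next P i lam x z‖ ≤ P.radius :=
  norm_convexCombination_le h0 h1 hx (norm_proj_le H.radius_nonneg _)

theorem norm_chi_le {lam : ℝ} (h0 : 0 ≤ lam) (h1 : lam ≤ 1) {x : Euc d}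
    (hx : ‖x‖ ≤ P.radius) (z : Euc d) : ‖chi P lam x z‖ ≤ P.radius :=
  norm_convexCombination_le h0 h1 hx (norm_proj_le H.radius_nonneg _)

/-- The estimate of one iteration. The quantity
`A_i (f(x_i) - f(xs)) + dualPotential z_i - ⟨z_i, xs⟩` increases by at most `A_i G_i(lam)`, the
defect that the line search makes small. -/
theorem potential_succ_le (i : ℕ) {lam : ℝ} (hlow : weightOf P i (1 / P.γn) ≤ lam) (h1 : lam ≤ weightOf P i P.γp)
    {x : Euc d} (hx : ‖x‖ ≤ P.radius) (z : Euc d) :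
    accRate P (i + 1) * (P.val (next P i lam x z) - P.val xs)
      + (dualPotential P.radius (z - (rate P (i + 1) / P.γn) • P.grad (next P i lam x z))
        - ⟪z - (rate P (i + 1) / P.γn) • P.grad (next P i lam x z), xs⟫)
      ≤ accRate P i * (P.val x - P.val xs) + (dualPotential P.radius z - ⟪z, xs⟫)
        + accRate P i * gapFun P i lam x z := by
  have h0 : 0 < lam := (H.weightOf_pos i (one_div_pos.mpr H.γn_pos)).trans_le hlow
  have hlam1 : lam ≤ 1 := h1.trans (H.weightOf_le_one i H.γp_pos)
  have hnext := H.norm_next_le i h0.le hlam1 hx z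
  have hchi := H.norm_chi_le h0.le hlam1 hx z
  have hα := H.step_pos i
  have hshort := H.step_mul_le h1
  have hn := H.γn_pos
  set α := rate P (i + 1) / P.γn with hαdef
  have hq : zeta P i lam x z = z - α • P.grad (chi P lam x z) := rfl
  set y := next P i lam x z with hy
  -- the prediction error `α ‖∇f(y) - ∇f(χ)‖` is at most `α L̃ lam ≤ 1` times the distance of the
  -- projections of `ζ` and `z`
  have hyq : y = (1 - lam) • x + lam • proj P.radius (zeta P i lam x z) := rfl
  have hdiff : y - chi P lam x z
      = lam • (proj P.radius (zeta P i lam x z) - proj P.radius z) := by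
    rw [hyq, chi]; module
  have herr : ‖α • P.grad y - α • P.grad (chi P lam x z)‖
      ≤ ‖proj P.radius (z - α • P.grad (chi P lam x z)) - proj P.radius z‖ := by
    rw [← smul_sub, norm_smul, Real.norm_of_nonneg hα.le, ← hq]
    have h2 := H.grad_lipschitz y _ hnext hchi
    rw [hdiff, norm_smul, Real.norm_of_nonneg h0.le] at h2
    calc _ ≤ α * (P.Lt * (lam * ‖proj P.radius (zeta P i lam x z) - proj P.radius z‖)) := by
          gcongr
      _ = (α * lam * P.Lt) * ‖proj P.radius (zeta P i lam x z) - proj P.radius z‖ := by ring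
      _ ≤ _ := mul_le_of_le_one_left (norm_nonneg _) hshort
  have hstep := dualPotential_sub_le H.radius_nonneg z _ _ herr
  rw [← hq] at hstep
  -- the loss of the projection of `ζ` splits into a loss of `y` and the slope of the line search
  have hgamma : accRate P i * gammaOf P i lam * lam = α * (1 - lam) := by
    rcases Nat.eq_zero_or_pos i with rfl | hi
    · -- here `gammaOf` divides by `A_0 = 0`, but both sides vanish since `lam = 1`
      have hA : accRate P 0 = 0 := by simp [accRate]
      have hw : weightOf P 0 (1 / P.γn) = 1 := by
        rw [weightOf, hA, zero_mul, zero_add (rate P (0 + 1) / P.γn)]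
        exact div_self (H.step_pos 0).ne'
      rw [hw] at hlow
      rw [hA, le_antisymm hlam1 hlow]
      simp
    · have hA := H.accRate_pos hi
      unfold gammaOf
      rw [← hαdef]
      field_simp
  have hlin : lam * (α * ⟪P.grad y, proj P.radius (zeta P i lam x z)⟫)
      = lam * (α * ⟪P.grad y, y⟫ + accRate P i * gammaOf P i lam * slope P i lam x z) := by
    have h3 : lam • proj P.radius (zeta P i lam x z) = y - (1 - lam) • x := by rw [hyq]; module
    have h4 : lam * ⟪P.grad y, proj P.radius (zeta P i lam x z)⟫
        = ⟪P.grad y, y⟫ - (1 - lam) * ⟪P.grad y, x⟫ := by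
      rw [← real_inner_smul_right, h3, inner_sub_right, real_inner_smul_right]
    have h5 : slope P i lam x z = ⟪P.grad y, y⟫ - ⟪P.grad y, x⟫ := by
      rw [slope, ← hy, inner_sub_right]
    rw [h5]
    linear_combination α * h4 - (⟪P.grad y, y⟫ - ⟪P.grad y, x⟫) * hgamma
  have hlin := mul_left_cancel₀ h0.ne' hlin
  have hmin : α * ⟪P.grad y, xs - y⟫ ≤ rate P (i + 1) * (P.val xs - P.val y) := by
    obtain ⟨θ, hθ, hθ', h6⟩ := H.tilted y xs hnext H.minimizer_mem
    have h7 := H.minimizer_le y hnext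
    have hθ0 : 0 < θ := H.γp_pos.trans_le hθ
    have h8 : θ * P.γn ≤ 1 := (le_div_iff₀ hn).mp hθ'
    have h9 : ⟪P.grad y, xs - y⟫ ≤ 0 := by
      by_contra! h
      nlinarith [mul_pos hθ0 h]
    have h10 : ⟪P.grad y, xs - y⟫ ≤ P.γn * (P.val xs - P.val y) := by
      nlinarith
    calc _ ≤ α * (P.γn * (P.val xs - P.val y)) := by gcongr
      _ = _ := by rw [hαdef]; field_simp
  rw [real_inner_smul_left, hlin] at hstep
  rw [inner_sub_right] at hmin
  rw [inner_sub_left, real_inner_smul_left, accRate_succ, gapFun, ← hy]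
  linarith

/-! ### The line search -/

theorem gapFun_nonpos_of_slope {i : ℕ} {lam : ℝ} (h0 : 0 ≤ lam) (h1 : lam ≤ 1)
    {x : Euc d} (hx : ‖x‖ ≤ P.radius) (z : Euc d)
    (h : 0 ≤ slope P i lam x z ∧ 1 / P.γn ≤ gammaOf P i lam ∨
      slope P i lam x z ≤ 0 ∧ gammaOf P i lam ≤ P.γp) :
    gapFun P i lam x z ≤ 0 := by
  obtain ⟨θ, hθ, hθ', h2⟩ := H.tilted _ x (H.norm_next_le i h0 h1 hx z) hx
  have h3 : ⟪P.grad (next P i lam x z), x - next P i lam x z⟫ = - slope P i lam x z := by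
    rw [slope, ← inner_neg_right, neg_sub]
  rw [h3] at h2
  unfold gapFun
  rcases h with ⟨hs, hγ⟩ | ⟨hs, hγ⟩ <;> nlinarith

theorem accepts_of_gapFun_nonpos {i : ℕ} {lam : ℝ} {x z : Euc d} (ht : 1 ≤ P.t)
    (h : gapFun P i lam x z ≤ 0) : Accepts P i lam x z := by
  have h1 := H.accRate_nonneg i
  have h2 : 0 ≤ accRate P P.t * P.ε := mul_nonneg (H.accRate_nonneg _) H.ε_pos.le
  have h3 : (1 : ℝ) ≤ P.t := by exact_mod_cast ht
  have h4 : 0 ≤ 2 * ((P.t : ℝ) - 1) * accRate P i := mul_nonneg (by linarith) h1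
  unfold Accepts
  nlinarith [mul_nonneg_of_nonpos_of_nonpos (neg_nonpos.mpr h4) h]

theorem val_next_le_of_slope_neg {i : ℕ} {lam : ℝ} (h0 : 0 ≤ lam) (h1 : lam ≤ 1)
    {x : Euc d} (hx : ‖x‖ ≤ P.radius) (z : Euc d) (h : slope P i lam x z < 0) :
    P.val (next P i lam x z) ≤ P.val x := by
  obtain ⟨θ, hθ, -, h2⟩ := H.tilted _ x (H.norm_next_le i h0 h1 hx z) hx
  have h3 : ⟪P.grad (next P i lam x z), x - next P i lam x z⟫ = - slope P i lam x z := by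
    rw [slope, ← inner_neg_right, neg_sub]
  rw [h3] at h2
  nlinarith [H.γp_pos]

theorem lt_val_next_of_not_accepts {i : ℕ} (hi : 0 < i) (hit : i < P.t) {lam : ℝ} (h0 : 0 < lam)
    (h1 : lam ≤ 1) {x z : Euc d} (hs : 0 ≤ slope P i lam x z) (h : ¬ Accepts P i lam x z) :
    P.val x + P.ε / (2 * ((P.t : ℝ) - 1)) < P.val (next P i lam x z) := by
  have hA := H.accRate_pos hi
  have hAt := H.accRate_mono hit.le
  have hα := H.step_pos i
  have ht : (1 : ℝ) < P.t := by exact_mod_cast (show 1 < P.t by omega)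
  have hγ : 0 ≤ gammaOf P i lam := by
    unfold gammaOf
    exact div_nonneg (mul_nonneg hα.le (by linarith)) (mul_pos hA h0).le
  have hgap : gapFun P i lam x z ≤ P.val (next P i lam x z) - P.val x := by
    unfold gapFun
    nlinarith [mul_nonneg hγ hs]
  unfold Accepts at h
  have h2 : accRate P i * P.ε ≤ accRate P P.t * P.ε :=
    mul_le_mul_of_nonneg_right hAt H.ε_pos.le
  have h3 : accRate P i * P.ε
      < accRate P i * ((P.val (next P i lam x z) - P.val x) * (2 * ((P.t : ℝ) - 1))) := by
    have : 2 * ((P.t : ℝ) - 1) * accRate P i * gapFun P i lam x z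
        ≤ 2 * ((P.t : ℝ) - 1) * accRate P i * (P.val (next P i lam x z) - P.val x) :=
      mul_le_mul_of_nonneg_left hgap (mul_nonneg (by linarith) hA.le)
    linarith
  have h4 := lt_of_mul_lt_mul_left h3 hA.le
  rw [← div_lt_iff₀ (by linarith)] at h4
  linarith

theorem norm_next_sub_next_le {i : ℕ} (hit : i < P.t) {lam mu : ℝ} (h0 : 0 ≤ lam) (h1 : lam ≤ 1)
    (h2 : 0 ≤ mu) (h3 : mu ≤ 1) {x : Euc d} (hx : ‖x‖ ≤ P.radius) (z : Euc d) :
    ‖next P i lam x z - next P i mu x z‖ ≤ 2 * P.radius * (1 + P.t) * |lam - mu| := by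
  have hα := H.step_pos i
  have hr := H.radius_nonneg
  have hdist : ∀ w, ‖proj P.radius w - x‖ ≤ 2 * P.radius := fun w =>
    (norm_sub_le _ _).trans (by linarith [norm_proj_le hr w])
  have hchi : chi P lam x z - chi P mu x z = (lam - mu) • (proj P.radius z - x) := by
    unfold chi; module
  have hαL : rate P (i + 1) / P.γn * P.Lt ≤ P.t := by
    have hn := H.γn_pos; have hp := H.γp_pos; have hL := H.Lt_pos
    have h4 : rate P (i + 1) / P.γn * P.Lt = (i + 1) * (P.γn * P.γp) / 2 := by
      unfold rate; push_cast; field_simp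
    have h5 : P.γn * P.γp ≤ 1 := mul_le_one₀ H.γn_le hp.le H.γp_le
    have h6 : (i : ℝ) + 1 ≤ P.t := by exact_mod_cast hit
    rw [h4]
    nlinarith [mul_pos hn hp, (Nat.cast_nonneg i : (0 : ℝ) ≤ i)]
  have hzeta : ‖zeta P i lam x z - zeta P i mu x z‖ ≤ P.t * (|lam - mu| * (2 * P.radius)) := by
    have h4 : zeta P i lam x z - zeta P i mu x z
        = (rate P (i + 1) / P.γn) • (P.grad (chi P mu x z) - P.grad (chi P lam x z)) := by
      unfold zeta; module
    have h5 := H.grad_lipschitz _ _ (H.norm_chi_le h2 h3 hx z) (H.norm_chi_le h0 h1 hx z)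
    rw [norm_sub_rev (chi P mu x z), hchi, norm_smul, Real.norm_eq_abs] at h5
    rw [h4, norm_smul, Real.norm_of_nonneg hα.le]
    calc _ ≤ rate P (i + 1) / P.γn * (P.Lt * (|lam - mu| * ‖proj P.radius z - x‖)) := by gcongr
      _ = (rate P (i + 1) / P.γn * P.Lt) * (|lam - mu| * ‖proj P.radius z - x‖) := by ring
      _ ≤ _ := by gcongr; exact hdist z
  have hsplit : next P i lam x z - next P i mu x z
      = (lam - mu) • (proj P.radius (zeta P i lam x z) - x)
        + mu • (proj P.radius (zeta P i lam x z) - proj P.radius (zeta P i mu x z)) := by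
    unfold next; module
  rw [hsplit]
  refine (norm_add_le _ _).trans ?_
  rw [norm_smul, norm_smul, Real.norm_eq_abs, Real.norm_of_nonneg h2]
  have h6 : mu * ‖proj P.radius (zeta P i lam x z) - proj P.radius (zeta P i mu x z)‖
      ≤ 1 * (P.t * (|lam - mu| * (2 * P.radius))) :=
    mul_le_mul h3 ((norm_proj_sub_le hr _ _).trans hzeta) (norm_nonneg _) zero_le_one
  have h7 := mul_le_mul_of_nonneg_left (hdist (zeta P i lam x z)) (abs_nonneg (lam - mu))
  linarith

/-- Bisection is entered with `f(x^l) ≤ f(x_i)` and `f(x^r) > f(x_i) + ε / (2 (t - 1))`, and failed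
tests preserve this. As `f(x^lam)` is Lipschitz in `lam`, the interval cannot become arbitrarily
short, and so a test succeeds. -/
theorem exists_bisect (hG : 0 ≤ G) {i : ℕ} (hi : 0 < i) (hit : i < P.t) {x : Euc d}
    (hx : ‖x‖ ≤ P.radius) (z : Euc d) (N : ℕ) : ∀ l r : ℝ, 0 < l → l ≤ r → r ≤ 1 →
      P.val (next P i l x z) ≤ P.val x →
      P.val x + P.ε / (2 * ((P.t : ℝ) - 1)) < P.val (next P i r x z) →
      G * (2 * P.radius * (1 + P.t)) * (r - l) ≤ 2 ^ N * (P.ε / (2 * ((P.t : ℝ) - 1))) →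
      ∃ lam q, Bisect P i x z l r lam q ∧ l ≤ lam ∧ lam ≤ r ∧ Accepts P i lam x z ∧ q ≤ 3 * N := by
  induction N with
  | zero =>
    intro l r hl hlr hr hfl hfr hlen
    exfalso
    have hl1 := hlr.trans hr
    have hr0 := hl.le.trans hlr
    have h1 := H.val_lipschitz _ _ (H.norm_next_le i hr0 hr hx z) (H.norm_next_le i hl.le hl1 hx z)
    have h2 := H.norm_next_sub_next_le hit hr0 hr hl.le hl1 hx z
    rw [abs_of_nonneg (by linarith)] at h2
    have h3 := mul_le_mul_of_nonneg_left h2 hG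
    rw [pow_zero, one_mul] at hlen
    linarith
  | succ N ih =>
    intro l r hl hlr hr hfl hfr hlen
    have hm0 : 0 < (l + r) / 2 := by linarith
    have hm1 : (l + r) / 2 ≤ 1 := by linarith
    rw [pow_succ] at hlen
    by_cases hacc : Accepts P i ((l + r) / 2) x z
    · exact ⟨_, _, .found l r hacc, by linarith, by linarith, hacc, by omega⟩
    rcases lt_or_ge (slope P i ((l + r) / 2) x z) 0 with hs | hs
    · obtain ⟨lam, q, hb, h1, h2, h3, h4⟩ := ih ((l + r) / 2) r hm0 (by linarith) hr
        (H.val_next_le_of_slope_neg hm0.le hm1 hx z hs) hfr (by linarith)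
      exact ⟨lam, _, .right l r lam q hacc hs hb, by linarith, h2, h3, by omega⟩
    · obtain ⟨lam, q, hb, h1, h2, h3, h4⟩ := ih l ((l + r) / 2) hl (by linarith) hm1 hfl
        (H.lt_val_next_of_not_accepts hi hit hm0 hm1 hs hacc) (by linarith)
      exact ⟨lam, _, .left l r lam q hacc hs hb, h1, by linarith, h3, by omega⟩

theorem exists_lineSearch (hG : 0 ≤ G) {i : ℕ} (hit : i < P.t) {x : Euc d}
    (hx : ‖x‖ ≤ P.radius) (z : Euc d) (N : ℕ)
    (hN : G * (2 * P.radius * (1 + P.t)) ≤ 2 ^ N * (P.ε / (2 * ((P.t : ℝ) - 1)))) :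
    ∃ lam q, LineSearch P i x z lam q ∧ weightOf P i (1 / P.γn) ≤ lam ∧ lam ≤ weightOf P i P.γp ∧
      Accepts P i lam x z ∧ q ≤ 3 * N + 6 := by
  have hn := H.γn_pos
  have hl := H.weightOf_pos i (one_div_pos.mpr hn)
  have hl1 := H.weightOf_le_one i (one_div_pos.mpr hn)
  have hr := H.weightOf_pos i H.γp_pos
  have hr1 := H.weightOf_le_one i H.γp_pos
  have hlr := H.weightOf_anti i H.γp_pos H.γp_le_inv
  by_cases h1 : Accepts P i (weightOf P i (1 / P.γn)) x z
  · exact ⟨_, _, .first h1, le_rfl, hlr, h1, by omega⟩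
  by_cases h2 : Accepts P i (weightOf P i P.γp) x z
  · exact ⟨_, _, .second h1 h2, hlr, le_rfl, h2, by omega⟩
  have hi : 0 < i := by
    rcases Nat.eq_zero_or_pos i with rfl | hi
    · refine absurd ?_ h1
      have : accRate P 0 = 0 := by simp [accRate]
      rw [Accepts, this, mul_zero, zero_mul]
      exact mul_nonneg (H.accRate_nonneg _) H.ε_pos.le
    · exact hi
  have hsl : slope P i (weightOf P i (1 / P.γn)) x z < 0 := by
    by_contra! hs
    refine h1 (H.accepts_of_gapFun_nonpos (by omega) (H.gapFun_nonpos_of_slope hl.le hl1 hx z ?_))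
    exact Or.inl ⟨hs, (H.gammaOf_weightOf hi (one_div_pos.mpr hn)).ge⟩
  have hsr : 0 ≤ slope P i (weightOf P i P.γp) x z := by
    by_contra! hs
    refine h2 (H.accepts_of_gapFun_nonpos (by omega) (H.gapFun_nonpos_of_slope hr.le hr1 hx z ?_))
    exact Or.inr ⟨hs.le, (H.gammaOf_weightOf hi H.γp_pos).le⟩
  have hΛ : 0 ≤ G * (2 * P.radius * (1 + P.t)) := by
    have := H.radius_nonneg
    positivity
  obtain ⟨lam, q, hb, h3, h4, h5, h6⟩ := H.exists_bisect hG hi hit hx z N _ _ hl hlr hr1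
    (H.val_next_le_of_slope_neg hl.le hl1 hx z hsl)
    (H.lt_val_next_of_not_accepts hi hit hr hr1 hsr h2)
    ((mul_le_of_le_one_right hΛ (by linarith)).trans hN)
  exact ⟨lam, _, .loop lam q h1 h2 hb, h3, h4, h5, by omega⟩

/-! ### Convergence of the algorithm -/

omit H in
theorem accRate_mul_gapFun_le {i : ℕ} (ht : 2 ≤ P.t) {lam : ℝ} {x z : Euc d}
    (h : Accepts P i lam x z) :
    accRate P i * gapFun P i lam x z
      ≤ if i = 0 then 0 else accRate P P.t * P.ε / (2 * ((P.t : ℝ) - 1)) := by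
  have ht' : (2 : ℝ) ≤ P.t := by exact_mod_cast ht
  split_ifs with hi
  · have : accRate P 0 = 0 := by simp [accRate]
    rw [hi, this, zero_mul]
  · rw [le_div_iff₀ (by linarith)]
    unfold Accepts at h
    linarith

theorem exists_run (hG : 0 ≤ G) (ht : 2 ≤ P.t) (N : ℕ)
    (hN : G * (2 * P.radius * (1 + P.t)) ≤ 2 ^ N * (P.ε / (2 * ((P.t : ℝ) - 1)))) :
    ∀ i ≤ P.t, ∃ x z q, Run P i x z q ∧ ‖x‖ ≤ P.radius ∧ q ≤ i * (3 * N + 8) ∧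
      accRate P i * (P.val x - P.val xs) + (dualPotential P.radius z - ⟪z, xs⟫)
        ≤ ((i - 1 : ℕ) : ℝ) * (accRate P P.t * P.ε / (2 * ((P.t : ℝ) - 1))) := by
  intro i
  induction i with
  | zero =>
    intro _
    refine ⟨0, 0, 0, .init, by simpa using H.radius_nonneg, by simp, ?_⟩
    have : accRate P 0 = 0 := by simp [accRate]
    simp [this, dualPotential, proj, H.radius_nonneg]
  | succ i ih =>
    intro hit
    obtain ⟨x, z, q, hrun, hx, hq, hpot⟩ := ih (by omega)
    obtain ⟨lam, n, hls, hlow, h1, hacc, hn⟩ :=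
      H.exists_lineSearch hG (i := i) (by omega) hx z N hN
    have h0 := (H.weightOf_pos i (one_div_pos.mpr H.γn_pos)).trans_le hlow
    have hlam1 := h1.trans (H.weightOf_le_one i H.γp_pos)
    refine ⟨_, _, _, .step i x z q lam n hrun hls, H.norm_next_le i h0.le hlam1 hx z, ?_, ?_⟩
    · have : (i + 1) * (3 * N + 8) = i * (3 * N + 8) + (3 * N + 8) := by ring
      omega
    · have h2 := H.potential_succ_le i hlow h1 hx z
      have h3 := accRate_mul_gapFun_le ht hacc
      rcases Nat.eq_zero_or_pos i with rfl | hi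
      · simp only [if_true] at h3
        simp only [zero_add, le_refl, Nat.sub_eq_zero_of_le, Nat.cast_zero, zero_mul,
          Nat.zero_sub] at hpot h2 ⊢
        linarith
      · rw [if_neg hi.ne'] at h3
        have h4 : ((i + 1 - 1 : ℕ) : ℝ) = ((i - 1 : ℕ) : ℝ) + 1 := by
          have : i + 1 - 1 = (i - 1) + 1 := by omega
          rw [this]; push_cast; ring
        rw [h4]
        linarith

/-- Convergence of the algorithm, with a bound on the number of queries: `N` bounds the number of
bisections in a line search. -/
theorem exists_returns (hG : 0 ≤ G) (ht : 2 ≤ P.t) (N : ℕ)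
    (hN : G * (2 * P.radius * (1 + P.t)) ≤ 2 ^ N * (P.ε / (2 * ((P.t : ℝ) - 1))))
    (hA : P.radius ^ 2 ≤ accRate P P.t * P.ε) :
    ∃ u q, Returns P u q ∧ ‖u‖ ≤ P.radius ∧ P.val u - P.val xs ≤ P.ε ∧ q ≤ P.t * (3 * N + 8) := by
  obtain ⟨u, z, q, hrun, hu, hq, hpot⟩ := H.exists_run hG ht N hN P.t le_rfl
  refine ⟨u, q, ⟨z, hrun⟩, hu, ?_, hq⟩
  have hAt : 0 < accRate P P.t := H.accRate_pos (by omega)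
  have ht' : (2 : ℝ) ≤ P.t := by exact_mod_cast ht
  have h1 := le_dualPotential H.radius_nonneg z H.minimizer_mem
  have h2 : ‖xs‖ ^ 2 ≤ P.radius ^ 2 := by
    have := H.minimizer_mem
    gcongr
  have h3 : ((P.t - 1 : ℕ) : ℝ) * (accRate P P.t * P.ε / (2 * ((P.t : ℝ) - 1)))
      = accRate P P.t * P.ε / 2 := by
    rw [Nat.cast_sub (by omega), Nat.cast_one]
    have : (P.t : ℝ) - 1 ≠ 0 := by linarith
    field_simp
  rw [h3] at hpot
  have h4 : accRate P P.t * (P.val u - P.val xs) ≤ accRate P P.t * P.ε := by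
    nlinarith [sq_nonneg ‖xs - proj P.radius z‖]
  exact le_of_mul_le_mul_left h4 hAt

end TiltedConvex

/-! ### The functions `cosK` and `sinK` -/

theorem cosK_sq_add (K r : ℝ) (hK : K ≠ 0) : cosK K r ^ 2 + K * sinK K r ^ 2 = 1 := by
  unfold cosK sinK
  split_ifs with h
  · have hs : Real.sqrt K ^ 2 = K := Real.sq_sqrt h.le
    have hs0 : Real.sqrt K ≠ 0 := (Real.sqrt_pos.mpr h).ne'
    rw [div_pow, hs, mul_div_cancel₀ _ hK, Real.cos_sq_add_sin_sq]
  · have hs : Real.sqrt (-K) ^ 2 = -K := Real.sq_sqrt (by linarith)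
    rw [div_pow, hs, div_neg, mul_neg, mul_div_cancel₀ _ hK, ← sub_eq_add_neg,
      Real.cosh_sq_sub_sinh_sq]

theorem cosK_zero (K : ℝ) : cosK K 0 = 1 := by simp [cosK]

theorem sinh_le_mul_exp (x : ℝ) : Real.sinh x ≤ x * Real.exp x := by
  have h1 := Real.add_one_le_exp (-2 * x)
  have h2 : Real.exp (-x) = Real.exp (-2 * x) * Real.exp x := by
    rw [← Real.exp_add]; congr 1; ring
  rw [Real.sinh_eq, h2]
  nlinarith [Real.exp_pos x]

/-- A value `c` of `cosK` that stays away from `-1`, the value at the conjugate point, is attained at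
a distance `D` that agrees with `sinK K D` to first order, uniformly in `c`. -/
theorem exists_dist_of_pos {K η : ℝ} (hK : 0 < K) (hη : 0 < η) :
    ∃ B : ℝ, 1 ≤ B ∧ ∀ c : ℝ, -1 + η ≤ c → c ≤ 1 → ∃ D, 0 ≤ D ∧ cosK K D = c ∧ 0 ≤ sinK K D ∧
      D ≤ B * sinK K D ∧ sinK K D ≤ B * D ∧ |D - sinK K D| ≤ B * sinK K D ^ 2 ∧
      D < Real.pi / Real.sqrt K := by
  have hk : 0 < Real.sqrt K := Real.sqrt_pos.mpr hK
  set k := Real.sqrt K with hkdef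
  have hpi := Real.pi_pos
  obtain ⟨b, hb1, hb2⟩ : ∃ b : ℝ, 1 ≤ b ∧ Real.pi ^ 2 ≤ b ^ 2 * η := by
    refine ⟨1 + Real.pi ^ 2 / η, by have : 0 < Real.pi ^ 2 / η := by positivity
                                    linarith, ?_⟩
    have h1 : Real.pi ^ 2 = Real.pi ^ 2 / η * η := by field_simp
    have h2 : 0 < Real.pi ^ 2 / η := by positivity
    nlinarith [mul_pos h2 hη, mul_pos (mul_pos h2 hη) h2]
  have hb0 : 0 < b := by linarith
  refine ⟨b + b ^ 2 * k, by nlinarith [mul_pos (pow_pos hb0 2) hk], fun c hc1 hc2 => ?_⟩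
  have hcos : Real.cos (Real.arccos c) = c := Real.cos_arccos (by linarith) hc2
  have hδ0 := Real.arccos_nonneg c
  have hδπ : Real.arccos c < Real.pi := by
    rcases (Real.arccos_le_pi c).lt_or_eq with h | h
    · exact h
    · rw [h, Real.cos_pi] at hcos; linarith
  set δ := Real.arccos c with hδ
  have hsin0 : 0 ≤ Real.sin δ := Real.sin_nonneg_of_nonneg_of_le_pi hδ0 hδπ.le
  have hsinle : Real.sin δ ≤ δ := Real.sin_le hδ0
  have hsq := Real.sin_sq_add_cos_sq δ
  -- `sin² δ = (1 - cos δ)(1 + cos δ) ≥ 2 η sin²(δ / 2)`, and `sin (δ / 2) ≥ δ / π`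
  have hδsin : δ ≤ b * Real.sin δ := by
    have h1 : 2 / Real.pi * (δ / 2) ≤ Real.sin (δ / 2) :=
      Real.mul_le_sin (by linarith) (by linarith)
    have h2 : Real.cos δ = 1 - 2 * Real.sin (δ / 2) ^ 2 := by
      have := Real.cos_sq' (δ / 2)
      have h3 := Real.cos_two_mul (δ / 2)
      rw [mul_div_cancel₀ _ (two_ne_zero' ℝ)] at h3
      linarith
    have h4 : δ ≤ Real.pi * Real.sin (δ / 2) := by
      have : 2 / Real.pi * (δ / 2) = δ / Real.pi := by field_simp
      rw [this, div_le_iff₀ hpi] at h1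
      linarith
    have h5 : 2 * Real.sin (δ / 2) ^ 2 * η ≤ Real.sin δ ^ 2 := by
      rw [hcos] at hsq h2
      nlinarith [sq_nonneg (Real.sin (δ / 2))]
    have h6 : δ ^ 2 ≤ Real.pi ^ 2 * Real.sin (δ / 2) ^ 2 := by
      rw [← mul_pow]; gcongr
    refine le_of_sq_le_sq ?_ (by positivity)
    calc δ ^ 2 ≤ Real.pi ^ 2 * Real.sin (δ / 2) ^ 2 := h6
      _ ≤ b ^ 2 * η * Real.sin (δ / 2) ^ 2 := by gcongr
      _ ≤ b ^ 2 * Real.sin δ ^ 2 := by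
          nlinarith [sq_nonneg (b * Real.sin (δ / 2)), sq_nonneg b, sq_nonneg (Real.sin (δ / 2)),
            mul_le_mul_of_nonneg_left h5 (sq_nonneg b)]
      _ = (b * Real.sin δ) ^ 2 := by ring
  have hcube : δ - Real.sin δ ≤ δ ^ 2 := by
    rcases hδ0.eq_or_lt with h0 | h0
    · rw [← h0]; simp
    have := Real.sin_gt_sub_cube h0
    rcases le_or_gt δ 1 with h1 | h1
    · nlinarith [sq_nonneg δ]
    · nlinarith
  have hS : sinK K (δ / k) = Real.sin δ / k := by
    rw [sinK, if_pos hK, ← hkdef, mul_div_cancel₀ _ hk.ne']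
  refine ⟨δ / k, by positivity, ?_, ?_, ?_, ?_, ?_, by gcongr⟩
  · rw [cosK, if_pos hK, ← hkdef, mul_div_cancel₀ _ hk.ne', hcos]
  · rw [hS]; positivity
  · rw [hS, ← mul_div_assoc]
    gcongr
    nlinarith [mul_nonneg (mul_pos (pow_pos hb0 2) hk).le hsin0]
  · rw [hS, ← mul_div_assoc]
    gcongr
    nlinarith [mul_nonneg (mul_pos (pow_pos hb0 2) hk).le hδ0]
  · rw [hS, ← sub_div, abs_of_nonneg (div_nonneg (by linarith) hk.le), div_le_iff₀ hk]
    have h1 : (b + b ^ 2 * k) * (Real.sin δ / k) ^ 2 * k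
        = b * Real.sin δ ^ 2 / k + (b * Real.sin δ) ^ 2 := by field_simp
    have h2 : 0 ≤ b * Real.sin δ ^ 2 / k := by positivity
    rw [h1]
    nlinarith

theorem exists_dist_of_neg {K m : ℝ} (hK : K < 0) (hm : 1 ≤ m) :
    ∃ B : ℝ, 1 ≤ B ∧ ∀ c : ℝ, 1 ≤ c → c ≤ m → ∃ D, 0 ≤ D ∧ cosK K D = c ∧ 0 ≤ sinK K D ∧
      D ≤ B * sinK K D ∧ sinK K D ≤ B * D ∧ |D - sinK K D| ≤ B * sinK K D ^ 2 := by
  have hk : 0 < Real.sqrt (-K) := Real.sqrt_pos.mpr (by linarith)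
  set k := Real.sqrt (-K) with hkdef
  refine ⟨2 * m + 2 * k, by linarith, fun c hc1 hc2 => ?_⟩
  have hcosh := Real.cosh_arcosh hc1
  have hδ0 := Real.arcosh_nonneg hc1
  set δ := Real.arcosh c with hδ
  have hsinh0 : 0 ≤ Real.sinh δ := Real.sinh_nonneg_iff.mpr hδ0
  have hle : δ ≤ Real.sinh δ := Real.self_le_sinh_iff.mpr hδ0
  have hexp := sinh_le_mul_exp δ
  have hsum := Real.cosh_add_sinh δ
  have hlt := Real.sinh_lt_cosh δ
  have hsq := Real.cosh_sq δ
  rw [hcosh] at hsum hlt hsq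
  have h1 : c ≤ 1 + Real.sinh δ := by
    by_contra! h
    nlinarith
  have hS : sinK K (δ / k) = Real.sinh δ / k := by
    rw [sinK, if_neg hK.not_gt, ← hkdef, mul_div_cancel₀ _ hk.ne']
  refine ⟨δ / k, by positivity, ?_, ?_, ?_, ?_, ?_⟩
  · rw [cosK, if_neg hK.not_gt, ← hkdef, mul_div_cancel₀ _ hk.ne', hcosh]
  · rw [hS]; positivity
  · rw [hS, ← mul_div_assoc]
    gcongr
    nlinarith [mul_nonneg hk.le hsinh0]
  · rw [hS, ← mul_div_assoc]
    gcongr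
    rw [← hsum] at hexp
    nlinarith [mul_nonneg hk.le hδ0]
  · rw [hS, ← sub_div, abs_of_nonpos (div_nonpos_of_nonpos_of_nonneg (by linarith) hk.le), ← neg_div,
      div_le_iff₀ hk]
    have h2 : (2 * m + 2 * k) * (Real.sinh δ / k) ^ 2 * k
        = 2 * m * Real.sinh δ ^ 2 / k + 2 * Real.sinh δ ^ 2 := by field_simp
    have h3 : 0 ≤ 2 * m * Real.sinh δ ^ 2 / k := by positivity
    rw [h2]
    rw [← hsum] at hexp
    nlinarith

/-! ### Geodesics in the coordinates of the geodesic map -/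

theorem form_comm (K : ℝ) (p q : Amb d) : form K p q = form K q p := by
  unfold form; rw [real_inner_comm, mul_comm p.1]

theorem form_add_right (K : ℝ) (p q q' : Amb d) :
    form K p (q + q') = form K p q + form K p q' := by
  simp only [form, Prod.fst_add, Prod.snd_add, inner_add_right]; ring

theorem form_smul_right (K : ℝ) (p q : Amb d) (a : ℝ) : form K p (a • q) = a * form K p q := by
  simp only [form, Prod.smul_fst, Prod.smul_snd, inner_smul_right, smul_eq_mul]; ring

theorem form_add_left (K : ℝ) (p p' q : Amb d) :
    form K (p + p') q = form K p q + form K p' q := by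
  rw [form_comm, form_add_right, form_comm K q, form_comm K q]

theorem form_smul_left (K : ℝ) (p q : Amb d) (a : ℝ) : form K (a • p) q = a * form K p q := by
  rw [form_comm, form_smul_right, form_comm]

theorem form_sub_right (K : ℝ) (p q q' : Amb d) :
    form K p (q - q') = form K p q - form K p q' := by
  simp only [form, Prod.fst_sub, Prod.snd_sub, inner_sub_right]; ring

theorem form_sub_left (K : ℝ) (p p' q : Amb d) :
    form K (p - p') q = form K p q - form K p' q := by
  rw [form_comm, form_sub_right, form_comm K q, form_comm K q]

/-- The factor `(1 + K ‖u‖²)^(-1/2)` by which `h⁻¹` rescales the point `x₀ + e u` of the tangent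
hyperplane. -/
noncomputable def centralScale (K : ℝ) (u : Euc d) : ℝ := (Real.sqrt (1 + K * ‖u‖ ^ 2))⁻¹

theorem geodInv_eq (K : ℝ) (x₀ : Amb d) (e : Euc d →ₗ[ℝ] Amb d) (u : Euc d) :
    geodInv K x₀ e u = centralScale K u • (x₀ + e u) := rfl

/-- The differential of `h⁻¹` at `u`. -/
noncomputable def geodInvDeriv (K : ℝ) (x₀ : Amb d) (e : Euc d →ₗ[ℝ] Amb d) (u : Euc d) : Euc d →ₗ[ℝ] Amb d :=
  centralScale K u • e - (centralScale K u ^ 3 * K) • (innerₛₗ ℝ u).smulRight (x₀ + e u)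

theorem geodInvDeriv_apply (K : ℝ) (x₀ : Amb d) (e : Euc d →ₗ[ℝ] Amb d) (u v : Euc d) :
    geodInvDeriv K x₀ e u v
      = centralScale K u • e v - (centralScale K u ^ 3 * K * ⟪u, v⟫) • (x₀ + e u) := by
  simp [geodInvDeriv, mul_smul]

theorem one_add_pos_of_norm_le {K r : ℝ} (hKr : 0 < 1 + K * r ^ 2) {u : Euc d} (hu : ‖u‖ ≤ r) :
    0 < 1 + K * ‖u‖ ^ 2 := by
  have h : ‖u‖ ^ 2 ≤ r ^ 2 := by gcongr
  rcases le_or_gt 0 K with hK | hK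
  · positivity
  · nlinarith

theorem centralScale_pos {K : ℝ} {u : Euc d} (hu : 0 < 1 + K * ‖u‖ ^ 2) : 0 < centralScale K u :=
  inv_pos.mpr (Real.sqrt_pos.mpr hu)

theorem centralScale_sq {K : ℝ} {u : Euc d} (hu : 0 < 1 + K * ‖u‖ ^ 2) :
    centralScale K u ^ 2 * (1 + K * ‖u‖ ^ 2) = 1 := by
  rw [centralScale, inv_pow, Real.sq_sqrt hu.le, inv_mul_cancel₀ hu.ne']

theorem exists_centralScale_bound {K r : ℝ} (hKr : 0 < 1 + K * r ^ 2) :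
    ∃ σ : ℝ, 1 ≤ σ ∧ ∀ (d : ℕ) (u : Euc d), ‖u‖ ≤ r →
      centralScale K u ≤ σ ∧ 1 ≤ σ * centralScale K u := by
  refine ⟨1 + (1 + K * r ^ 2)⁻¹ + |K| * r ^ 2, by
    have : 0 < (1 + K * r ^ 2)⁻¹ := by positivity
    have : 0 ≤ |K| * r ^ 2 := by positivity
    linarith, fun d u hu => ?_⟩
  have hn := one_add_pos_of_norm_le hKr hu
  have hs := centralScale_pos hn
  have hs2 := centralScale_sq hn
  have hur : ‖u‖ ^ 2 ≤ r ^ 2 := by gcongr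
  have hi : 0 < (1 + K * r ^ 2)⁻¹ := by positivity
  have hi' : (1 + K * r ^ 2)⁻¹ * (1 + K * r ^ 2) = 1 := inv_mul_cancel₀ hKr.ne'
  have ha : 0 ≤ |K| * r ^ 2 := by positivity
  set s := centralScale K u
  set i := (1 + K * r ^ 2)⁻¹
  have hup : 1 + K * ‖u‖ ^ 2 ≤ 1 + |K| * r ^ 2 := by
    nlinarith [le_abs_self K, abs_nonneg K, sq_nonneg ‖u‖]
  have hlow : s ^ 2 ≤ 1 + i := by
    have h1 : 1 ≤ (1 + i) * (1 + K * ‖u‖ ^ 2) := by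
      rcases le_or_gt 0 K with hK | hK
      · nlinarith [mul_nonneg hK (sq_nonneg ‖u‖), mul_nonneg hi.le (mul_nonneg hK (sq_nonneg ‖u‖))]
      · have : 1 + K * r ^ 2 ≤ 1 + K * ‖u‖ ^ 2 := by nlinarith
        nlinarith
    by_contra! h
    nlinarith
  constructor
  · have : s ≤ 1 + i := by
      by_contra! h
      nlinarith
    linarith
  · have h1 : 1 ≤ s ^ 2 * (1 + |K| * r ^ 2) := by nlinarith [sq_nonneg s]
    have h2 : 1 ≤ s * (1 + |K| * r ^ 2) := by
      by_contra! h
      nlinarith [mul_pos hs (show 0 < 1 + |K| * r ^ 2 by linarith)]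
    nlinarith [mul_pos hi hs]

section Frame

variable {K : ℝ} {x₀ : Amb d} {e : Euc d →ₗ[ℝ] Amb d}

theorem form_add_frame (hx₀ : x₀ ∈ modelSpace K d) (he : IsFrame K x₀ e) (u w : Euc d) :
    form K (x₀ + e u) (x₀ + e w) = 1 / K + ⟪u, w⟫ := by
  rw [form_add_left, form_add_right, form_add_right, he.2, hx₀.1, he.1 w, form_comm, he.1 u]
  ring

theorem form_add_frame_right (he : IsFrame K x₀ e) (u w : Euc d) :
    form K (x₀ + e u) (e w) = ⟪u, w⟫ := by
  rw [form_add_left, he.2, he.1 w, zero_add]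

/-- The function `cosK` of the distance of `h⁻¹(u)` and `h⁻¹(w)`. -/
noncomputable def cosDist (K : ℝ) (u w : Euc d) : ℝ :=
  centralScale K u * centralScale K w * (1 + K * ⟪u, w⟫)

theorem form_geodInv (hK : K ≠ 0) (hx₀ : x₀ ∈ modelSpace K d) (he : IsFrame K x₀ e)
    (u w : Euc d) : form K (geodInv K x₀ e u) (geodInv K x₀ e w) = cosDist K u w / K := by
  rw [geodInv_eq, geodInv_eq, form_smul_left, form_smul_right, form_add_frame hx₀ he, cosDist]
  field_simp

theorem cosDist_self {u : Euc d} (hu : 0 < 1 + K * ‖u‖ ^ 2) : cosDist K u u = 1 := by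
  rw [cosDist, real_inner_self_eq_norm_sq]; linear_combination centralScale_sq hu

theorem geodInvDeriv_mem_tangent (hK : K ≠ 0) (hx₀ : x₀ ∈ modelSpace K d) (he : IsFrame K x₀ e)
    {u : Euc d} (hu : 0 < 1 + K * ‖u‖ ^ 2) (v : Euc d) :
    geodInvDeriv K x₀ e u v ∈ tangent K (geodInv K x₀ e u) := by
  have h := centralScale_sq hu
  rw [tangent, Set.mem_ofPred_eq, geodInvDeriv_apply, geodInv_eq, form_smul_left, form_sub_right,
    form_smul_right, form_smul_right, form_add_frame_right he, form_add_frame hx₀ he,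
    real_inner_self_eq_norm_sq]
  field_simp
  linear_combination (-centralScale K u ^ 2 * ⟪u, v⟫) * h

/-- The geodesic map sends geodesics to line segments. -/
theorem geodInv_sub_smul (u w : Euc d) (hu : 0 < 1 + K * ‖u‖ ^ 2) :
    geodInv K x₀ e w - cosDist K u w • geodInv K x₀ e u
      = (centralScale K w / centralScale K u) • geodInvDeriv K x₀ e u (w - u) := by
  have h := centralScale_sq hu
  have hs := centralScale_pos hu
  have h1 : (centralScale K w / centralScale K u) * centralScale K u = centralScale K w := by
    field_simp
  have h2 : centralScale K w - cosDist K u w * centralScale K u + centralScale K w *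
      (centralScale K u ^ 2 * K * ⟪u, w - u⟫) = 0 := by
    rw [cosDist, inner_sub_right, real_inner_self_eq_norm_sq]
    linear_combination (-centralScale K w) * h
  have h3 : (centralScale K w / centralScale K u) * (centralScale K u ^ 3 * K * ⟪u, w - u⟫)
      = centralScale K w * (centralScale K u ^ 2 * K * ⟪u, w - u⟫) := by
    field_simp
  have h4 : cosDist K u w * centralScale K u = centralScale K w + centralScale K w *
      (centralScale K u ^ 2 * K * ⟪u, w - u⟫) := by linarith
  rw [geodInvDeriv_apply, geodInv_eq, geodInv_eq, smul_sub, smul_smul, smul_smul, smul_smul, h1, h3,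
    h4, map_sub]
  module

end Frame

/-! ### Distances and velocities in the coordinates of the geodesic map -/

section Distance

variable {K r : ℝ}

/-- The square of `sinK` of the distance of `h⁻¹(u)` and `h⁻¹(w)`, up to the conformal factors. -/
noncomputable def chordSq (K : ℝ) (u w : Euc d) : ℝ :=
  ‖w - u‖ ^ 2 * (1 + K * ‖u‖ ^ 2) - K * ⟪u, w - u⟫ ^ 2

theorem mul_sub_eq_chordSq (K : ℝ) (u w : Euc d) :
    (1 + K * ‖u‖ ^ 2) * (1 + K * ‖w‖ ^ 2) - (1 + K * ⟪u, w⟫) ^ 2 = K * chordSq K u w := by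
  have h : ‖w - u‖ ^ 2 = ‖w‖ ^ 2 - 2 * ⟪u, w⟫ + ‖u‖ ^ 2 := by
    rw [norm_sub_sq_real, real_inner_comm]
  rw [chordSq, h, inner_sub_right, real_inner_self_eq_norm_sq]
  ring

theorem cosDist_comm (K : ℝ) (u w : Euc d) : cosDist K u w = cosDist K w u := by
  rw [cosDist, cosDist, real_inner_comm]; ring

theorem one_sub_cosDist_sq {u w : Euc d} (hu : 0 < 1 + K * ‖u‖ ^ 2) (hw : 0 < 1 + K * ‖w‖ ^ 2) :
    1 - cosDist K u w ^ 2 = K * (centralScale K u ^ 2 * centralScale K w ^ 2 * chordSq K u w) := by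
  have h1 := centralScale_sq hu
  have h2 := centralScale_sq hw
  have h3 := mul_sub_eq_chordSq K u w
  rw [cosDist]
  linear_combination (-1 : ℝ) * h1 - centralScale K u ^ 2 * (1 + K * ‖u‖ ^ 2) * h2
    + centralScale K u ^ 2 * centralScale K w ^ 2 * h3

theorem inner_sq_le (u v : Euc d) : ⟪u, v⟫ ^ 2 ≤ ‖u‖ ^ 2 * ‖v‖ ^ 2 := by
  rw [← mul_pow]
  exact sq_le_sq' (by linarith [neg_le_of_abs_le (abs_real_inner_le_norm u v)])
    (real_inner_le_norm u v)

theorem chordSq_pos {u w : Euc d} (hu : 0 < 1 + K * ‖u‖ ^ 2) (huw : u ≠ w) :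
    0 < chordSq K u w := by
  have h0 : 0 < ‖w - u‖ ^ 2 := pow_pos (norm_pos_iff.mpr (sub_ne_zero.mpr huw.symm)) 2
  have h1 := inner_sq_le u (w - u)
  unfold chordSq
  rcases le_or_gt 0 K with hK | hK
  · nlinarith
  · nlinarith [mul_pos h0 hu, sq_nonneg ⟪u, w - u⟫]

theorem chordSq_le {u w : Euc d} (hu : ‖u‖ ≤ r) :
    chordSq K u w ≤ ‖w - u‖ ^ 2 * (1 + |K| * r ^ 2) := by
  have h1 := inner_sq_le u (w - u)
  have h2 : ‖u‖ ^ 2 ≤ r ^ 2 := by gcongr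
  have h3 : |K| * ‖u‖ ^ 2 * ‖w - u‖ ^ 2 ≤ |K| * r ^ 2 * ‖w - u‖ ^ 2 := by gcongr
  unfold chordSq
  rcases le_or_gt 0 K with hK | hK
  · rw [abs_of_nonneg hK] at *
    nlinarith [mul_nonneg hK (sq_nonneg ⟪u, w - u⟫)]
  · rw [abs_of_neg hK] at *
    nlinarith

/-- In the sphere, points of the ball stay away from each other's antipodes. -/
theorem cosDist_bounds_of_pos (hK : 0 < K) {u w : Euc d} (hu : ‖u‖ ≤ r) (hw : ‖w‖ ≤ r) :
    -1 + (1 + K * r ^ 2)⁻¹ ≤ cosDist K u w ∧ cosDist K u w ≤ 1 := by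
  have hnu : 0 < 1 + K * ‖u‖ ^ 2 := by positivity
  have hnw : 0 < 1 + K * ‖w‖ ^ 2 := by positivity
  have hsu := centralScale_pos hnu
  have hsw := centralScale_pos hnw
  have hr : 0 < 1 + K * r ^ 2 := by positivity
  constructor
  · set η := (1 + K * r ^ 2)⁻¹ with hη
    have hη0 : 0 < η := inv_pos.mpr hr
    have hη1 : η ≤ 1 := inv_le_one_of_one_le₀ (by nlinarith [mul_nonneg hK.le (sq_nonneg r)])
    have hab : ‖u‖ * ‖w‖ ≤ r ^ 2 := by
      rw [sq]; exact mul_le_mul hu hw (norm_nonneg _) ((norm_nonneg _).trans hu)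
    have hηab : η * (1 + K * (‖u‖ * ‖w‖)) ≤ 1 := by
      rw [hη, inv_mul_le_iff₀ hr]; nlinarith
    have hinner : -(‖u‖ * ‖w‖) ≤ ⟪u, w⟫ := neg_le_of_abs_le (abs_real_inner_le_norm u w)
    -- by `(1 + K ‖u‖ ‖w‖)² ≤ (1 + K ‖u‖²)(1 + K ‖w‖²)`
    have hp : centralScale K u * centralScale K w * (1 + K * (‖u‖ * ‖w‖)) ≤ 1 := by
      have h1 := centralScale_sq hnu
      have h2 := centralScale_sq hnw
      refine le_of_sq_le_sq ?_ zero_le_one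
      have h3 : (1 + K * (‖u‖ * ‖w‖)) ^ 2 ≤ (1 + K * ‖u‖ ^ 2) * (1 + K * ‖w‖ ^ 2) := by
        nlinarith [mul_nonneg hK.le (sq_nonneg (‖u‖ - ‖w‖))]
      calc _ = centralScale K u ^ 2 * centralScale K w ^ 2 * (1 + K * (‖u‖ * ‖w‖)) ^ 2 := by ring
        _ ≤ centralScale K u ^ 2 * centralScale K w ^ 2
            * ((1 + K * ‖u‖ ^ 2) * (1 + K * ‖w‖ ^ 2)) := by gcongr
        _ = (centralScale K u ^ 2 * (1 + K * ‖u‖ ^ 2))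
            * (centralScale K w ^ 2 * (1 + K * ‖w‖ ^ 2)) := by ring
        _ = 1 ^ 2 := by rw [h1, h2]; norm_num
    have hp0 := mul_pos hsu hsw
    unfold cosDist
    set p := centralScale K u * centralScale K w
    have h4 : 1 - K * (‖u‖ * ‖w‖) ≤ 1 + K * ⟪u, w⟫ := by nlinarith
    have h5 : K * (‖u‖ * ‖w‖) - 1 ≤ (1 - η) * (1 + K * (‖u‖ * ‖w‖)) := by linarith
    have h6 : p * (K * (‖u‖ * ‖w‖) - 1) ≤ 1 - η := by
      calc _ ≤ p * ((1 - η) * (1 + K * (‖u‖ * ‖w‖))) := by gcongr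
        _ = (1 - η) * (p * (1 + K * (‖u‖ * ‖w‖))) := by ring
        _ ≤ (1 - η) * 1 := by gcongr
        _ = _ := mul_one _
    nlinarith
  · by_cases huw : u = w
    · rw [huw, cosDist_self hnw]
    have h1 := one_sub_cosDist_sq hnu hnw
    have h2 := chordSq_pos hnu huw
    have h3 : 0 < K * (centralScale K u ^ 2 * centralScale K w ^ 2 * chordSq K u w) := by
      positivity
    nlinarith

theorem one_le_cosDist_of_neg (hK : K < 0) (hKr : 0 < 1 + K * r ^ 2) {u w : Euc d}
    (hu : ‖u‖ ≤ r) (hw : ‖w‖ ≤ r) : 1 ≤ cosDist K u w := by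
  have hnu := one_add_pos_of_norm_le hKr hu
  have hnw := one_add_pos_of_norm_le hKr hw
  by_cases huw : u = w
  · rw [huw, cosDist_self hnw]
  have hsu := centralScale_pos hnu
  have hsw := centralScale_pos hnw
  have h1 := one_sub_cosDist_sq hnu hnw
  have h2 := chordSq_pos hnu huw
  have h3 : 0 < centralScale K u ^ 2 * centralScale K w ^ 2 * chordSq K u w := by positivity
  have h4 : ⟪u, w⟫ ≤ r ^ 2 := (real_inner_le_norm u w).trans
    (by rw [sq]; exact mul_le_mul hu hw (norm_nonneg _) ((norm_nonneg _).trans hu))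
  have h5 : 0 < cosDist K u w := by
    have : 0 < 1 + K * ⟪u, w⟫ := by nlinarith
    unfold cosDist; positivity
  nlinarith

theorem cosDist_le {σ : ℝ} (hσ : 1 ≤ σ)
    (hs : ∀ u : Euc d, ‖u‖ ≤ r → centralScale K u ≤ σ ∧ 1 ≤ σ * centralScale K u)
    {u w : Euc d} (hu : ‖u‖ ≤ r) (hw : ‖w‖ ≤ r) : cosDist K u w ≤ σ ^ 2 * (1 + |K| * r ^ 2) := by
  have hu0 : 0 < centralScale K u := by nlinarith [hs u hu]
  have hw0 : 0 < centralScale K w := by nlinarith [hs w hw]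
  have h4 : |⟪u, w⟫| ≤ r ^ 2 := (abs_real_inner_le_norm u w).trans
    (by rw [sq]; exact mul_le_mul hu hw (norm_nonneg _) ((norm_nonneg _).trans hu))
  have h5 : 1 + K * ⟪u, w⟫ ≤ 1 + |K| * r ^ 2 := by
    have : K * ⟪u, w⟫ ≤ |K| * |⟪u, w⟫| := by rw [← abs_mul]; exact le_abs_self _
    nlinarith [mul_le_mul_of_nonneg_left h4 (abs_nonneg K)]
  have h6 : 0 ≤ 1 + |K| * r ^ 2 := by positivity
  unfold cosDist
  rw [sq]
  calc _ ≤ centralScale K u * centralScale K w * (1 + |K| * r ^ 2) := by gcongr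
    _ ≤ _ := by
      gcongr
      · exact (hs u hu).1
      · exact (hs w hw).1

/-- The comparison of `D` and `sinK K D`, for the distances that occur in a ball. -/
theorem exists_dist (hK : K ≠ 0) (hKr : 0 < 1 + K * r ^ 2) :
    ∃ B : ℝ, 1 ≤ B ∧ ∀ (d : ℕ) (u w : Euc d), ‖u‖ ≤ r → ‖w‖ ≤ r →
      ∃ D, 0 ≤ D ∧ cosK K D = cosDist K u w ∧ 0 ≤ sinK K D ∧
        D ≤ B * sinK K D ∧ sinK K D ≤ B * D ∧ |D - sinK K D| ≤ B * sinK K D ^ 2 ∧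
        (0 < K → D < Real.pi / Real.sqrt K) := by
  rcases hK.lt_or_gt with hK | hK
  · obtain ⟨σ, hσ, hs⟩ := exists_centralScale_bound hKr
    have hm : 1 ≤ σ ^ 2 * (1 + |K| * r ^ 2) := by
      have h1 : 0 ≤ |K| * r ^ 2 := by positivity
      have h2 : 1 ≤ σ ^ 2 := one_le_pow₀ hσ
      nlinarith
    obtain ⟨B, hB, h⟩ := exists_dist_of_neg hK hm
    refine ⟨B, hB, fun d u w hu hw => ?_⟩
    obtain ⟨D, h1, h2, h3, h4, h5, h6⟩ :=
      h _ (one_le_cosDist_of_neg hK hKr hu hw) (cosDist_le hσ (hs d) hu hw)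
    exact ⟨D, h1, h2, h3, h4, h5, h6, fun hK' => absurd hK' hK.not_gt⟩
  · obtain ⟨B, hB, h⟩ := exists_dist_of_pos hK (inv_pos.mpr hKr)
    refine ⟨B, hB, fun d u w hu hw => ?_⟩
    obtain ⟨h7, h8⟩ := cosDist_bounds_of_pos hK hu hw
    obtain ⟨D, h1, h2, h3, h4, h5, h6, h9⟩ := h _ h7 h8
    exact ⟨D, h1, h2, h3, h4, h5, h6, fun _ => h9⟩

theorem abs_centralScale_div_sub_one_le {σ : ℝ} (hr : 0 ≤ r) (hKr : 0 < 1 + K * r ^ 2)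
    (hs : ∀ u : Euc d, ‖u‖ ≤ r → centralScale K u ≤ σ ∧ 1 ≤ σ * centralScale K u)
    {u w : Euc d} (hu : ‖u‖ ≤ r) (hw : ‖w‖ ≤ r) :
    |centralScale K w / centralScale K u - 1| ≤ 2 * |K| * r * σ ^ 2 * ‖w - u‖ := by
  have hnu := one_add_pos_of_norm_le hKr hu
  have hnw := one_add_pos_of_norm_le hKr hw
  have hsu := centralScale_pos hnu
  have hsw := centralScale_pos hnw
  have h1 := centralScale_sq hnu
  have h2 := centralScale_sq hnw
  set q := centralScale K w / centralScale K u with hq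
  have hq0 : 0 < q := div_pos hsw hsu
  have hq2 : q ^ 2 - 1 = K * (‖u‖ ^ 2 - ‖w‖ ^ 2) * centralScale K w ^ 2 := by
    have h3 : q ^ 2 = centralScale K w ^ 2 * (1 + K * ‖u‖ ^ 2) := by
      rw [hq, div_pow, div_eq_iff (by positivity)]
      linear_combination (-centralScale K w ^ 2) * h1
    rw [h3]
    linear_combination h2
  have h4 : |q - 1| ≤ |q ^ 2 - 1| := by
    have : q ^ 2 - 1 = (q - 1) * (q + 1) := by ring
    rw [this, abs_mul, abs_of_pos (show 0 < q + 1 by linarith)]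
    nlinarith [abs_nonneg (q - 1)]
  have h5 : |‖u‖ ^ 2 - ‖w‖ ^ 2| ≤ 2 * r * ‖w - u‖ := by
    have : ‖u‖ ^ 2 - ‖w‖ ^ 2 = (‖u‖ + ‖w‖) * (‖u‖ - ‖w‖) := by ring
    rw [this, abs_mul, abs_of_nonneg (by positivity), norm_sub_rev w u]
    exact mul_le_mul (by linarith) (abs_norm_sub_norm_le u w) (abs_nonneg _) (by linarith)
  have h6 : centralScale K w ^ 2 ≤ σ ^ 2 := by
    have := (hs w hw).1
    gcongr
  refine h4.trans ?_
  rw [hq2, abs_mul, abs_mul, abs_of_nonneg (sq_nonneg (centralScale K w))]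
  calc _ ≤ |K| * (2 * r * ‖w - u‖) * σ ^ 2 := by gcongr
    _ = _ := by ring

/-- The initial velocity of the geodesic from `h⁻¹(u)` to `h⁻¹(w)` is a multiple `θ` of the image of
`w - u` under the differential of `h⁻¹`. On a ball the factor `θ` is bounded above and below, and it
tends to `1` linearly as `w → u`. All bounds depend on the curvature and the radius only. -/
theorem exists_isExpInv (hK : K ≠ 0) (hr : 0 ≤ r) (hKr : 0 < 1 + K * r ^ 2) :
    ∃ B : ℝ, 1 ≤ B ∧ ∀ (d : ℕ) (x₀ : Amb d) (e : Euc d →ₗ[ℝ] Amb d), x₀ ∈ modelSpace K d →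
      IsFrame K x₀ e → ∀ u w : Euc d, ‖u‖ ≤ r → ‖w‖ ≤ r → ∃ θ : ℝ,
        1 ≤ B * θ ∧ θ ≤ B ∧ |θ - 1| ≤ B * ‖w - u‖ ∧
        IsExpInv K (geodInv K x₀ e u) (geodInv K x₀ e w) (θ • geodInvDeriv K x₀ e u (w - u)) ∧
        tnorm K (θ • geodInvDeriv K x₀ e u (w - u)) ≤ B * ‖w - u‖ ∧
        cosK K (tnorm K (θ • geodInvDeriv K x₀ e u (w - u))) = cosDist K u w := by
  obtain ⟨σ, hσ, hs⟩ := exists_centralScale_bound hKr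
  obtain ⟨B, hB, hdist⟩ := exists_dist hK hKr
  set E := σ ^ 2 * (1 + |K| * r ^ 2) with hE
  have hE0 : 0 < E := by positivity
  set B' := B * σ ^ 2 + B * E + B * E * σ ^ 2 + 2 * |K| * r * σ ^ 2 with hB'
  have hBσ : 1 ≤ B * σ ^ 2 := one_le_mul_of_one_le_of_one_le hB (one_le_pow₀ hσ)
  have hp1 : 0 ≤ B * E := by positivity
  have hp2 : 0 ≤ B * E * σ ^ 2 := by positivity
  have hp3 : 0 ≤ 2 * |K| * r * σ ^ 2 := by positivity
  refine ⟨B', by linarith, fun d x₀ e hx₀ he u w hu hw => ?_⟩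
  have hnu := one_add_pos_of_norm_le hKr hu
  have hnw := one_add_pos_of_norm_le hKr hw
  by_cases huw : u = w
  · subst huw
    have h0 : tnorm K (0 : Amb d) = 0 := by simp [tnorm, form]
    refine ⟨1, by linarith, by linarith, by simp, ?_⟩
    simp only [sub_self, map_zero, smul_zero, h0, norm_zero, mul_zero, le_refl, cosK_zero,
      cosDist_self hnu, and_true]
    refine ⟨by simp [tangent, form], by simp [expMap, h0, cosK_zero], fun hK' => ?_⟩
    rw [h0]
    have := Real.pi_pos
    have := Real.sqrt_pos.mpr hK'
    positivity
  obtain ⟨D, hD0, hcos, hS0, hDS, hSD, hdiff, hDπ⟩ := hdist d u w hu hw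
  have hsu := centralScale_pos hnu
  have hsw := centralScale_pos hnw
  set S := sinK K D with hSdef
  have hS2 : S ^ 2 = centralScale K u ^ 2 * centralScale K w ^ 2 * chordSq K u w := by
    have h1 := cosK_sq_add K D hK
    have h2 := one_sub_cosDist_sq hnu hnw
    rw [hcos] at h1
    exact mul_left_cancel₀ hK (by linarith)
  have hSpos : 0 < S := by
    refine hS0.lt_of_ne fun h => ?_
    rw [← h] at hS2
    have := chordSq_pos hnu huw
    have : 0 < centralScale K u ^ 2 * centralScale K w ^ 2 * chordSq K u w := by positivity
    linarith [hS2]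
  have hDpos : 0 < D := by
    by_contra! h
    nlinarith
  have hSE : S ≤ E * ‖w - u‖ := by
    refine le_of_sq_le_sq ?_ (by positivity)
    have h1 : centralScale K u ^ 2 ≤ σ ^ 2 := by have := (hs d u hu).1; gcongr
    have h2 : centralScale K w ^ 2 ≤ σ ^ 2 := by have := (hs d w hw).1; gcongr
    have h3 : 1 + |K| * r ^ 2 ≤ (1 + |K| * r ^ 2) ^ 2 :=
      le_self_pow₀ (by have : 0 ≤ |K| * r ^ 2 := by positivity
                       linarith) two_ne_zero
    calc S ^ 2 = centralScale K u ^ 2 * centralScale K w ^ 2 * chordSq K u w := hS2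
      _ ≤ σ ^ 2 * σ ^ 2 * (‖w - u‖ ^ 2 * (1 + |K| * r ^ 2) ^ 2) := by
          have := chordSq_pos hnu huw
          gcongr
          exact (chordSq_le hu).trans (by gcongr)
      _ = (E * ‖w - u‖) ^ 2 := by rw [hE]; ring
  -- `θ` is the product of `q`, which comes from the scale factors, and `p = D / sinK K D`
  set q := centralScale K w / centralScale K u with hq
  have hq0 : 0 < q := div_pos hsw hsu
  have hqle : q ≤ σ ^ 2 := by
    rw [hq, div_le_iff₀ hsu]
    nlinarith [(hs d w hw).1, (hs d u hu).2]
  have hqge : 1 ≤ σ ^ 2 * q := by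
    rw [hq, ← mul_div_assoc, le_div_iff₀ hsu]
    nlinarith [(hs d u hu).1, (hs d w hw).2]
  have hq1 := abs_centralScale_div_sub_one_le hr hKr (hs d) hu hw
  rw [← hq] at hq1
  set p := D / S with hp
  have hp0 : 0 < p := div_pos hDpos hSpos
  have hpB : p ≤ B := (div_le_iff₀ hSpos).mpr hDS
  have hBp : 1 ≤ B * p := by rw [hp, ← mul_div_assoc, le_div_iff₀ hSpos]; linarith
  have hp1' : |p - 1| ≤ B * E * ‖w - u‖ := by
    have h1 : p - 1 = (D - S) / S := by rw [hp]; field_simp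
    rw [h1, abs_div, abs_of_pos hSpos, div_le_iff₀ hSpos]
    calc _ ≤ B * S ^ 2 := hdiff
      _ = B * S * S := by ring
      _ ≤ B * (E * ‖w - u‖) * S := by gcongr
      _ = _ := by ring
  have hv : (p * q) • geodInvDeriv K x₀ e u (w - u)
      = p • (geodInv K x₀ e w - cosDist K u w • geodInv K x₀ e u) := by
    rw [geodInv_sub_smul u w hnu, ← hq, smul_smul]
  have hnorm : tnorm K ((p * q) • geodInvDeriv K x₀ e u (w - u)) = D := by
    have h1 : form K (geodInv K x₀ e w - cosDist K u w • geodInv K x₀ e u)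
        (geodInv K x₀ e w - cosDist K u w • geodInv K x₀ e u) = S ^ 2 := by
      simp only [form_sub_left, form_sub_right, form_smul_left, form_smul_right,
        form_geodInv hK hx₀ he, cosDist_comm K w u,
        cosDist_self hnu, cosDist_self hnw]
      rw [hS2]
      have h2 := one_sub_cosDist_sq hnu hnw
      field_simp
      linear_combination h2
    rw [tnorm, hv, form_smul_left, form_smul_right, h1, hp]
    have : D / S * (D / S * S ^ 2) = D ^ 2 := by field_simp
    rw [this, Real.sqrt_sq hD0]
  have hw0 : 0 ≤ ‖w - u‖ := norm_nonneg _
  refine ⟨p * q, ?_, ?_, ?_, ⟨?_, ?_, ?_⟩, ?_, ?_⟩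
  · have h1 : 1 ≤ (B * p) * (σ ^ 2 * q) := one_le_mul_of_one_le_of_one_le hBp hqge
    have h2 : 0 ≤ (B * E + B * E * σ ^ 2 + 2 * |K| * r * σ ^ 2) * (p * q) := by positivity
    rw [hB']; linarith
  · have h1 : p * q ≤ B * σ ^ 2 := mul_le_mul hpB hqle hq0.le (by linarith)
    linarith
  · have h1 : p * q - 1 = (p - 1) * q + (q - 1) := by ring
    rw [h1]
    refine (abs_add_le _ _).trans ?_
    rw [abs_mul, abs_of_pos hq0]
    have h2 : |p - 1| * q ≤ B * E * ‖w - u‖ * σ ^ 2 :=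
      mul_le_mul hp1' hqle hq0.le (by positivity)
    have h3 : 0 ≤ (B * σ ^ 2 + B * E) * ‖w - u‖ := by positivity
    rw [hB']; linarith
  · have h1 := geodInvDeriv_mem_tangent hK hx₀ he hnu (w - u)
    change form K _ _ = 0 at h1 ⊢
    rw [form_smul_right, h1, mul_zero]
  · rw [expMap, hnorm, hcos, ← hSdef, hv, smul_smul]
    have : S / D * p = 1 := by rw [hp]; field_simp
    rw [this, one_smul]
    abel
  · rw [hnorm]; exact hDπ
  · rw [hnorm]
    have h1 : B * S ≤ B * (E * ‖w - u‖) := by gcongr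
    have h3 : 0 ≤ (B * σ ^ 2 + B * E * σ ^ 2 + 2 * |K| * r * σ ^ 2) * ‖w - u‖ := by positivity
    rw [hB']; linarith
  · rw [hnorm, hcos]

end Distance

/-! ### Geodesic balls -/

theorem cosK_pos {K R : ℝ} (hR : 0 ≤ R) (hKR : 0 < K → R < Real.pi / (2 * Real.sqrt K)) :
    0 < cosK K R := by
  unfold cosK
  split_ifs with h
  · have hk := Real.sqrt_pos.mpr h
    have h1 := hKR h
    rw [lt_div_iff₀ (by positivity)] at h1
    exact Real.cos_pos_of_mem_Ioo ⟨by nlinarith [Real.pi_pos], by linarith⟩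
  · exact Real.cosh_pos _

theorem ballRadius_eq (K R : ℝ) : ballRadius K R = sinK K R / cosK K R := by
  unfold ballRadius sinK cosK
  split_ifs
  · rw [Real.tan_eq_sin_div_cos, div_right_comm]
  · rw [Real.tanh_eq_sinh_div_cosh, div_right_comm]

theorem cosK_sq_mul_one_add {K R : ℝ} (hK : K ≠ 0) (hc : 0 < cosK K R) :
    cosK K R ^ 2 * (1 + K * ballRadius K R ^ 2) = 1 := by
  rw [ballRadius_eq, div_pow, mul_add, mul_one, mul_left_comm, mul_div_cancel₀ _ (by positivity)]
  exact cosK_sq_add K R hK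

theorem one_add_ballRadius_pos {K R : ℝ} (hK : K ≠ 0) (hc : 0 < cosK K R) :
    0 < 1 + K * ballRadius K R ^ 2 := by
  have h := cosK_sq_mul_one_add hK hc
  exact pos_of_mul_pos_right (by rw [h]; exact one_pos) (sq_nonneg (cosK K R))

theorem ballRadius_mono {K ρ R : ℝ} (hρ : 0 ≤ ρ) (hρR : ρ ≤ R)
    (hKR : 0 < K → R < Real.pi / (2 * Real.sqrt K)) : ballRadius K ρ ≤ ballRadius K R := by
  unfold ballRadius
  split_ifs with h
  · have hk := Real.sqrt_pos.mpr h
    have h1 := hKR h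
    rw [lt_div_iff₀ (by positivity)] at h1
    have h2 : Real.sqrt K * ρ ≤ Real.sqrt K * R := by gcongr
    have h3 : 0 ≤ Real.sqrt K * ρ := by positivity
    have hpi := Real.pi_pos
    gcongr
    exact Real.strictMonoOn_tan.monotoneOn ⟨by linarith, by linarith⟩ ⟨by linarith, by linarith⟩ h2
  · rw [Real.tanh_eq_sinh_div_cosh, Real.tanh_eq_sinh_div_cosh]
    gcongr ?_ / _
    rw [div_le_div_iff₀ (Real.cosh_pos _) (Real.cosh_pos _)]
    have h1 : 0 ≤ Real.sinh (Real.sqrt (-K) * R - Real.sqrt (-K) * ρ) := by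
      rw [Real.sinh_nonneg_iff, ← mul_sub]
      exact mul_nonneg (Real.sqrt_nonneg _) (by linarith)
    rw [Real.sinh_sub] at h1
    linarith

theorem ballRadius_nonneg {K R : ℝ} (hR : 0 ≤ R)
    (hKR : 0 < K → R < Real.pi / (2 * Real.sqrt K)) : 0 ≤ ballRadius K R := by
  have h : ballRadius K 0 = 0 := by simp [ballRadius]
  exact h ▸ ballRadius_mono le_rfl hR hKR

section Frame

variable {K : ℝ} {x₀ : Amb d} {e : Euc d →ₗ[ℝ] Amb d}

theorem centralScale_zero : centralScale K (0 : Euc d) = 1 := by simp [centralScale]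

theorem geodInv_zero : geodInv K x₀ e 0 = x₀ := by
  rw [geodInv_eq, centralScale_zero, map_zero, add_zero, one_smul]

/-- `h⁻¹` maps the Euclidean ball into the geodesic ball. -/
theorem geodInv_mem_closedGeodBall {R : ℝ} (hK : K ≠ 0) (hR : 0 ≤ R)
    (hKR : 0 < K → R < Real.pi / (2 * Real.sqrt K)) (hx₀ : x₀ ∈ modelSpace K d)
    (he : IsFrame K x₀ e) {u : Euc d} (hu : ‖u‖ ≤ ballRadius K R) :
    geodInv K x₀ e u ∈ closedGeodBall K x₀ R := by
  have hc := cosK_pos hR hKR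
  have hr := ballRadius_nonneg hR hKR
  have hKr := one_add_ballRadius_pos hK hc
  obtain ⟨B, -, h⟩ := exists_isExpInv hK hr hKr
  obtain ⟨θ, -, -, -, ⟨hv1, hv2, hv3⟩, -, hv4⟩ :=
    h d x₀ e hx₀ he 0 u (by rwa [norm_zero]) hu
  rw [geodInv_zero] at hv1 hv2
  refine ⟨_, hv1, ?_, hv2⟩
  have hnu := one_add_pos_of_norm_le hKr hu
  have hsu := centralScale_pos hnu
  have h1 := centralScale_sq hnu
  have h2 := cosK_sq_mul_one_add hK hc
  rw [cosDist, centralScale_zero, inner_zero_left, mul_zero, add_zero, one_mul, mul_one] at hv4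
  set D := tnorm K (θ • geodInvDeriv K x₀ e 0 (u - 0)) with hD
  have hD0 : 0 ≤ D := Real.sqrt_nonneg _
  have hur : ‖u‖ ^ 2 ≤ ballRadius K R ^ 2 := by gcongr
  by_contra! hlt
  rcases hK.lt_or_gt with hK' | hK'
  · have h3 : cosK K R < cosK K D := by
      rw [cosK, cosK, if_neg hK'.not_gt, if_neg hK'.not_gt, Real.cosh_lt_cosh,
        abs_of_nonneg (by positivity), abs_of_nonneg (by positivity)]
      have : 0 < Real.sqrt (-K) := Real.sqrt_pos.mpr (by linarith)
      gcongr
    rw [hv4] at h3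
    have h4 : cosK K R ^ 2 < centralScale K u ^ 2 := by gcongr
    have h5 : K * ballRadius K R ^ 2 ≤ K * ‖u‖ ^ 2 := mul_le_mul_of_nonpos_left hur hK'.le
    nlinarith
  · have hk := Real.sqrt_pos.mpr hK'
    have h3 : cosK K D < cosK K R := by
      have h4 := hv3 hK'
      rw [lt_div_iff₀ hk] at h4
      rw [cosK, cosK, if_pos hK', if_pos hK']
      exact Real.cos_lt_cos_of_nonneg_of_le_pi (by positivity) (by linarith) (by gcongr)
    rw [hv4] at h3
    have h4 : centralScale K u ^ 2 < cosK K R ^ 2 := by gcongr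
    have h5 : K * ‖u‖ ^ 2 ≤ K * ballRadius K R ^ 2 := by gcongr
    nlinarith

/-- The form with a fixed first argument, as a linear map. -/
noncomputable def formLin (K : ℝ) (p : Amb d) : Amb d →ₗ[ℝ] ℝ where
  toFun := form K p
  map_add' := form_add_right K p
  map_smul' a q := form_smul_right K p q a

/-- A frame is a map onto the tangent space, by a dimension count. -/
theorem exists_frame_eq (hK : K ≠ 0) (hx₀ : x₀ ∈ modelSpace K d) (he : IsFrame K x₀ e)
    {v : Amb d} (hv : v ∈ tangent K x₀) : ∃ u, e u = v := by
  have hne : formLin K x₀ ≠ 0 := by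
    intro h
    have h1 : formLin K x₀ x₀ = 0 := by rw [h]; rfl
    have h2 : formLin K x₀ x₀ = 1 / K := hx₀.1
    rw [h2] at h1
    exact one_div_ne_zero hK h1
  have hinj : Function.Injective e := by
    rw [injective_iff_map_eq_zero]
    intro u hu
    have h1 := he.2 u u
    rw [hu] at h1
    have h2 : form K (0 : Amb d) 0 = 0 := by simp [form]
    rw [h2] at h1
    exact inner_self_eq_zero.mp h1.symm
  have h1 := Module.Dual.finrank_ker_add_one_of_ne_zero hne
  have h2 : Module.finrank ℝ (Amb d) = 1 + d := by simp
  have h3 := LinearMap.finrank_range_of_inj hinj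
  have h4 : Module.finrank ℝ (Euc d) = d := by simp
  have h5 : LinearMap.range e = LinearMap.ker (formLin K x₀) := by
    refine Submodule.eq_of_le_of_finrank_eq ?_ (by omega)
    rintro _ ⟨u, rfl⟩
    exact he.1 u
  have h6 : v ∈ LinearMap.range e := by rw [h5]; exact hv
  exact h6

/-- Every point of the geodesic ball is `h⁻¹(u)` for some `u` in the Euclidean ball. -/
theorem exists_geodInv_eq {R : ℝ} (hK : K ≠ 0)
    (hKR : 0 < K → R < Real.pi / (2 * Real.sqrt K)) (hx₀ : x₀ ∈ modelSpace K d)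
    (he : IsFrame K x₀ e) {p : Amb d} (hp : p ∈ closedGeodBall K x₀ R) :
    ∃ u, ‖u‖ ≤ ballRadius K R ∧ geodInv K x₀ e u = p := by
  obtain ⟨v, hv, hvR, rfl⟩ := hp
  obtain ⟨u, rfl⟩ := exists_frame_eq hK hx₀ he hv
  have hn : tnorm K (e u) = ‖u‖ := by
    rw [tnorm, he.2, real_inner_self_eq_norm_sq, Real.sqrt_sq (norm_nonneg _)]
  rw [hn] at hvR
  have hc := cosK_pos (norm_nonneg u) fun h => hvR.trans_lt (hKR h)
  have hrad : ballRadius K ‖u‖ = sinK K ‖u‖ / cosK K ‖u‖ := ballRadius_eq _ _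
  have hnonneg := ballRadius_nonneg (norm_nonneg u) fun h => hvR.trans_lt (hKR h)
  have hnorm : ‖(ballRadius K ‖u‖ / ‖u‖) • u‖ = ballRadius K ‖u‖ := by
    rw [norm_smul, Real.norm_of_nonneg (by positivity)]
    rcases eq_or_ne u 0 with rfl | h
    · simp [ballRadius]
    · rw [div_mul_cancel₀ _ (norm_ne_zero_iff.mpr h)]
  refine ⟨(ballRadius K ‖u‖ / ‖u‖) • u, ?_, ?_⟩
  · rw [hnorm]; exact ballRadius_mono (norm_nonneg u) hvR hKR
  · have hs : centralScale K ((ballRadius K ‖u‖ / ‖u‖) • u) = cosK K ‖u‖ := by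
      rw [centralScale, hnorm, eq_div_of_mul_eq (by positivity)
        ((mul_comm _ _).trans (cosK_sq_mul_one_add hK hc)), Real.sqrt_div zero_le_one,
        Real.sqrt_one, Real.sqrt_sq hc.le, one_div, inv_inv]
    rw [geodInv_eq, hs, expMap, hn, map_smul, smul_add, smul_smul, hrad]
    congr 2
    field_simp

/-! ### The gradient in the coordinates of the geodesic map -/

theorem hasRiemGradAt_riemGrad {F : Amb d → ℝ} {p : Amb d} (h : RiemDifferentiableAt K F p) :
    HasRiemGradAt K F p (riemGrad K F p) := by
  have h' : ∃ g, HasRiemGradAt K F p g := h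
  rw [riemGrad, dif_pos h']
  exact h'.choose_spec

/-- The chain rule for `F ∘ h⁻¹`. Riemannian differentiability is a statement about the exponential
map; it is compared with `h⁻¹` through `exists_isExpInv`, where `θ → 1`. -/
theorem hasFDerivAt_comp_geodInv {r : ℝ} (hK : K ≠ 0) (hKr : 0 < 1 + K * r ^ 2)
    (hx₀ : x₀ ∈ modelSpace K d) (he : IsFrame K x₀ e) {F : Amb d → ℝ} {u : Euc d} (hu : ‖u‖ < r)
    {g : Amb d} (hg : HasRiemGradAt K F (geodInv K x₀ e u) g) :
    HasFDerivAt (fun w => F (geodInv K x₀ e w))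
      (LinearMap.toContinuousLinearMap (formLin K g ∘ₗ geodInvDeriv K x₀ e u)) u := by
  obtain ⟨B, hB, h⟩ := exists_isExpInv hK ((norm_nonneg u).trans hu.le) hKr
  have h' : ∀ w : Euc d, ∃ θ : ℝ, ‖w‖ ≤ r → |θ| ≤ B ∧ |θ - 1| ≤ B * ‖w - u‖ ∧
      θ • geodInvDeriv K x₀ e u (w - u) ∈ tangent K (geodInv K x₀ e u) ∧
      expMap K (geodInv K x₀ e u) (θ • geodInvDeriv K x₀ e u (w - u)) = geodInv K x₀ e w ∧
      tnorm K (θ • geodInvDeriv K x₀ e u (w - u)) ≤ B * ‖w - u‖ := by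
    intro w
    by_cases hw : ‖w‖ ≤ r
    · obtain ⟨θ, h1, h2, h3, h4, h5, -⟩ := h d x₀ e hx₀ he u w hu.le hw
      have h6 : 0 ≤ θ := by nlinarith
      exact ⟨θ, fun _ => ⟨by rwa [abs_of_nonneg h6], h3, h4.1, h4.2.1, h5⟩⟩
    · exact ⟨0, fun h => absurd h hw⟩
  choose θ hθ using h'
  set ℓ := LinearMap.toContinuousLinearMap (formLin K g ∘ₗ geodInvDeriv K x₀ e u) with hℓ
  set V : Euc d → Amb d := fun w => θ w • geodInvDeriv K x₀ e u (w - u) with hV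
  have hev : ∀ᶠ w in 𝓝 u, ‖w‖ ≤ r :=
    (continuous_norm.tendsto u).eventually (Iic_mem_nhds hu)
  have hVlim : Filter.Tendsto V (𝓝 u) (𝓝[tangent K (geodInv K x₀ e u)] 0) := by
    refine tendsto_nhdsWithin_iff.mpr ⟨?_, hev.mono fun w hw => (hθ w hw).2.2.1⟩
    have h1 : Filter.Tendsto (fun w => geodInvDeriv K x₀ e u (w - u)) (𝓝 u) (𝓝 0) := by
      have h2 : Continuous fun w => geodInvDeriv K x₀ e u (w - u) :=
        (LinearMap.continuous_of_finiteDimensional _).comp (by fun_prop)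
      have h3 := h2.tendsto u
      rwa [sub_self, map_zero] at h3
    refine squeeze_zero_norm' (a := fun w => B * ‖geodInvDeriv K x₀ e u (w - u)‖) ?_ ?_
    · refine hev.mono fun w hw => ?_
      rw [hV, norm_smul, Real.norm_eq_abs]
      exact mul_le_mul_of_nonneg_right (hθ w hw).1 (norm_nonneg _)
    · simpa using h1.norm.const_mul B
  have hmain : (fun w => F (geodInv K x₀ e w) - F (geodInv K x₀ e u) - form K g (V w))
      =o[𝓝 u] fun w => w - u := by
    have h1 := hg.2.comp_tendsto hVlim
    have h2 : ((fun v : Amb d => tnorm K v) ∘ V) =O[𝓝 u] fun w => w - u := by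
      refine Asymptotics.IsBigO.of_bound B (hev.mono fun w hw => ?_)
      rw [Function.comp_apply, tnorm, Real.norm_of_nonneg (Real.sqrt_nonneg _)]
      exact (hθ w hw).2.2.2.2
    refine (h1.trans_isBigO h2).congr' (hev.mono fun w hw => ?_) Filter.EventuallyEq.rfl
    simp only [Function.comp_apply, hV, (hθ w hw).2.2.2.1]
  have hrem : (fun w => form K g (V w) - ℓ (w - u)) =o[𝓝 u] fun w => w - u := by
    have h1 : (fun w => form K g (V w) - ℓ (w - u)) =O[𝓝 u] fun w => ‖w - u‖ ^ 2 := by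
      refine Asymptotics.IsBigO.of_bound (B * ‖ℓ‖) (hev.mono fun w hw => ?_)
      have h2 : form K g (V w) - ℓ (w - u) = (θ w - 1) * ℓ (w - u) := by
        rw [hV, form_smul_right, sub_mul, one_mul]
        rfl
      rw [h2, norm_mul, Real.norm_eq_abs, norm_pow, norm_norm]
      calc _ ≤ (B * ‖w - u‖) * (‖ℓ‖ * ‖w - u‖) :=
            mul_le_mul (hθ w hw).2.1 (ℓ.le_opNorm _) (norm_nonneg _) (by positivity)
        _ = _ := by ring
    refine h1.trans_isLittleO ?_
    rw [Asymptotics.isLittleO_norm_right.symm]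
    have h3 : Filter.Tendsto (fun w : Euc d => ‖w - u‖) (𝓝 u) (𝓝 0) := by
      have : Continuous fun w : Euc d => ‖w - u‖ := by fun_prop
      simpa using this.tendsto u
    have h4 : (fun w : Euc d => ‖w - u‖) =o[𝓝 u] fun _ => (1 : ℝ) :=
      (Asymptotics.isLittleO_one_iff ℝ).mpr h3
    have h5 := h4.mul_isBigO (Asymptotics.isBigO_refl (fun w : Euc d => ‖w - u‖) (𝓝 u))
    simpa [sq] using h5
  rw [hasFDerivAt_iff_isLittleO]
  refine (hmain.add hrem).congr (fun w => ?_) fun w => rfl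
  ring

theorem inner_gradient_comp_geodInv {R : ℝ} (hK : K ≠ 0) (hR : 0 ≤ R)
    (hKR : 0 < K → R < Real.pi / (2 * Real.sqrt K)) (hx₀ : x₀ ∈ modelSpace K d)
    (he : IsFrame K x₀ e) {F : Amb d → ℝ} {u : Euc d} (hu : ‖u‖ ≤ ballRadius K R)
    (hF : RiemDifferentiableAt K F (geodInv K x₀ e u)) (v : Euc d) :
    ⟪gradient (fun w => F (geodInv K x₀ e w)) u, v⟫
      = form K (riemGrad K F (geodInv K x₀ e u)) (geodInvDeriv K x₀ e u v) := by
  -- for `u` on the boundary of the ball, the estimates are needed on a slightly larger ball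
  obtain ⟨r, hr, hKr⟩ : ∃ r, ballRadius K R < r ∧ 0 < 1 + K * r ^ 2 := by
    have h1 : ∀ᶠ s in 𝓝 (ballRadius K R), 0 < 1 + K * s ^ 2 := by
      have : Continuous fun s : ℝ => 1 + K * s ^ 2 := by fun_prop
      exact (this.tendsto _).eventually
        (lt_mem_nhds (one_add_ballRadius_pos hK (cosK_pos hR hKR)))
    obtain ⟨s, h2, h3⟩ := ((h1.filter_mono nhdsWithin_le_nhds).and
      (self_mem_nhdsWithin (a := ballRadius K R) (s := Set.Ioi (ballRadius K R)))).exists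
    exact ⟨s, h3, h2⟩
  rw [inner_gradient_left, (hasFDerivAt_comp_geodInv hK hKr hx₀ he (hu.trans_lt hr)
    (hasRiemGradAt_riemGrad hF)).fderiv]
  rfl

end Frame

/-- The geometric content of the theorem. In the coordinates of the geodesic map, `L`-smoothness and
geodesic convexity turn into two-sided estimates by linearizations, in which the linear term carries
a factor `θ` that is bounded above and below and tends to `1` linearly. -/
theorem exists_linearization_bounds {K R : ℝ} (hK : K ≠ 0) (hR : 0 ≤ R)
    (hKR : 0 < K → R < Real.pi / (2 * Real.sqrt K)) :
    ∃ B : ℝ, 1 ≤ B ∧ ∀ (d : ℕ) (x₀ : Amb d), x₀ ∈ modelSpace K d →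
      ∀ e : Euc d →ₗ[ℝ] Amb d, IsFrame K x₀ e → ∀ (F : Amb d → ℝ) (L : ℝ), 0 < L →
      (∀ p ∈ closedGeodBall K x₀ R, RiemDifferentiableAt K F p) →
      SmoothOn K L F (closedGeodBall K x₀ R) → GConvexOn K F (closedGeodBall K x₀ R) →
      ∀ u w : Euc d, ‖u‖ ≤ ballRadius K R → ‖w‖ ≤ ballRadius K R → ∃ θ : ℝ,
        1 ≤ B * θ ∧ θ ≤ B ∧ |θ - 1| ≤ B * ‖w - u‖ ∧
        F (geodInv K x₀ e u)
            + θ * ⟪gradient (fun w => F (geodInv K x₀ e w)) u, w - u⟫ ≤ F (geodInv K x₀ e w) ∧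
        F (geodInv K x₀ e w) ≤ F (geodInv K x₀ e u)
            + θ * ⟪gradient (fun w => F (geodInv K x₀ e w)) u, w - u⟫
            + L / 2 * (B * ‖w - u‖) ^ 2 := by
  have hc := cosK_pos hR hKR
  have hr := ballRadius_nonneg hR hKR
  have hKr := one_add_ballRadius_pos hK hc
  obtain ⟨B, hB, h⟩ := exists_isExpInv hK hr hKr
  refine ⟨B, hB, fun d x₀ hx₀ e he F L hL hF hs hconv u w hu hw => ?_⟩
  obtain ⟨θ, h1, h2, h3, h4, h5, -⟩ := h d x₀ e hx₀ he u w hu hw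
  have hmu := geodInv_mem_closedGeodBall hK hR hKR hx₀ he hu
  have hmw := geodInv_mem_closedGeodBall hK hR hKR hx₀ he hw
  have hgrad := inner_gradient_comp_geodInv hK hR hKR hx₀ he hu (hF _ hmu) (w - u)
  have h6 := hs _ hmu _ hmw _ h4
  have h7 := hconv _ hmu _ hmw _ h4
  rw [form_smul_right, ← hgrad] at h6 h7
  refine ⟨θ, h1, h2, h3, h7, h6.trans ?_⟩
  have h8 : 0 ≤ tnorm K (θ • geodInvDeriv K x₀ e u (w - u)) := Real.sqrt_nonneg _
  gcongr

/-! ### Consequences of the linearization bounds -/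

section Linearization

variable {r B L : ℝ} {f : Euc d → ℝ} {g : Euc d → Euc d} {xs : Euc d}

/-- On the ball of radius `r`, the function `f` is estimated from below and above by its
linearizations with the gradient `g`, up to a factor `θ` in front of the linear term. -/
def LinearizationBounds (r B L : ℝ) (f : Euc d → ℝ) (g : Euc d → Euc d) : Prop :=
  ∀ u w : Euc d, ‖u‖ ≤ r → ‖w‖ ≤ r → ∃ θ : ℝ,
    1 ≤ B * θ ∧ θ ≤ B ∧ |θ - 1| ≤ B * ‖w - u‖ ∧
    f u + θ * ⟪g u, w - u⟫ ≤ f w ∧ f w ≤ f u + θ * ⟪g u, w - u⟫ + L / 2 * (B * ‖w - u‖) ^ 2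

namespace LinearizationBounds

theorem le_of_critical (h : LinearizationBounds r B L f g) (hxs : ‖xs‖ ≤ r)
    (hcrit : ∀ v, ⟪g xs, v⟫ = 0) {w : Euc d} (hw : ‖w‖ ≤ r) : f xs ≤ f w := by
  obtain ⟨θ, -, -, -, h1, -⟩ := h xs w hxs hw
  rwa [hcrit, mul_zero, add_zero] at h1

theorem sub_le_of_critical (h : LinearizationBounds r B L f g) (hxs : ‖xs‖ ≤ r)
    (hcrit : ∀ v, ⟪g xs, v⟫ = 0) {w : Euc d} (hw : ‖w‖ ≤ r) :
    f w - f xs ≤ L / 2 * (B * ‖w - xs‖) ^ 2 := by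
  obtain ⟨θ, -, -, -, -, h1⟩ := h xs w hxs hw
  rw [hcrit, mul_zero, add_zero] at h1
  linarith

theorem norm_sub_le_two_mul {u w : Euc d} (hu : ‖u‖ ≤ r) (hw : ‖w‖ ≤ r) : ‖w - u‖ ≤ 2 * r :=
  (norm_sub_le _ _).trans (by linarith)

theorem abs_inner_le (h : LinearizationBounds r B L f g) (hB : 1 ≤ B) (hL : 0 < L)
    (hxs : ‖xs‖ ≤ r) (hcrit : ∀ v, ⟪g xs, v⟫ = 0) {u w : Euc d} (hu : ‖u‖ ≤ r) (hw : ‖w‖ ≤ r) :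
    |⟪g u, w - u⟫| ≤ 4 * L * B ^ 3 * r ^ 2 := by
  have hr : 0 ≤ r := (norm_nonneg u).trans hu
  have hosc : ∀ {a b : Euc d}, ‖a‖ ≤ r → ‖b‖ ≤ r →
      L / 2 * (B * ‖a - b‖) ^ 2 ≤ 2 * L * B ^ 2 * r ^ 2 := by
    intro a b ha hb
    have h1 := norm_sub_le_two_mul hb ha
    calc _ ≤ L / 2 * (B * (2 * r)) ^ 2 := by gcongr
      _ = _ := by ring
  obtain ⟨θ, h1, h2, -, h4, h5⟩ := h u w hu hw
  have h6 := hosc hw hu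
  have h7 := (h.sub_le_of_critical hxs hcrit hu).trans (hosc hu hxs)
  have h8 := (h.sub_le_of_critical hxs hcrit hw).trans (hosc hw hxs)
  have h9 := h.le_of_critical hxs hcrit hu
  have h10 := h.le_of_critical hxs hcrit hw
  have hθ : 0 < θ := by nlinarith
  have h11 : |θ * ⟪g u, w - u⟫| ≤ 4 * L * B ^ 2 * r ^ 2 := by
    rw [abs_le]
    have : 0 ≤ 2 * L * B ^ 2 * r ^ 2 := by positivity
    constructor <;> linarith
  rw [abs_mul, abs_of_pos hθ] at h11
  calc |⟪g u, w - u⟫| ≤ (B * θ) * |⟪g u, w - u⟫| := le_mul_of_one_le_left (abs_nonneg _) h1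
    _ = B * (θ * |⟪g u, w - u⟫|) := by ring
    _ ≤ B * (4 * L * B ^ 2 * r ^ 2) := by gcongr
    _ = _ := by ring

/-- The gradient is bounded, as the oscillation of `f` on the ball is. -/
theorem norm_le (h : LinearizationBounds r B L f g) (hr : 0 < r) (hB : 1 ≤ B) (hL : 0 < L)
    (hxs : ‖xs‖ ≤ r) (hcrit : ∀ v, ⟪g xs, v⟫ = 0) {u : Euc d} (hu : ‖u‖ ≤ r) :
    ‖g u‖ ≤ 4 * L * B ^ 3 * r := by
  rcases eq_or_ne (g u) 0 with h0 | h0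
  · rw [h0, norm_zero]; positivity
  have hg : 0 < ‖g u‖ := norm_pos_iff.mpr h0
  have hw : ‖(r / ‖g u‖) • g u‖ = r := by
    rw [norm_smul, Real.norm_of_nonneg (by positivity), div_mul_cancel₀ _ hg.ne']
  have h1 := (abs_le.mp (h.abs_inner_le hB hL hxs hcrit hu hw.le)).2
  have h2 := (abs_le.mp (h.abs_inner_le hB hL hxs hcrit hu
    (w := -((r / ‖g u‖) • g u)) (by rw [norm_neg, hw]))).1
  rw [inner_sub_right, real_inner_smul_right, real_inner_self_eq_norm_sq] at h1
  rw [inner_sub_right, inner_neg_right, real_inner_smul_right, real_inner_self_eq_norm_sq] at h2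
  have h3 : r / ‖g u‖ * ‖g u‖ ^ 2 = r * ‖g u‖ := by field_simp
  have h4 : r * ‖g u‖ ≤ r * (4 * L * B ^ 3 * r) := by rw [h3] at h1 h2; linarith
  exact le_of_mul_le_mul_left h4 hr

theorem sub_le (h : LinearizationBounds r B L f g) (hr : 0 < r) (hB : 1 ≤ B) (hL : 0 < L)
    (hxs : ‖xs‖ ≤ r) (hcrit : ∀ v, ⟪g xs, v⟫ = 0) {u w : Euc d} (hu : ‖u‖ ≤ r) (hw : ‖w‖ ≤ r) :
    f u - f w ≤ 4 * B ^ 4 * r * L * ‖u - w‖ := by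
  obtain ⟨θ, h1, h2, -, h4, -⟩ := h u w hu hw
  have hθ : 0 < θ := by nlinarith
  have h5 : -(‖g u‖ * ‖w - u‖) ≤ ⟪g u, w - u⟫ := neg_le_of_abs_le (abs_real_inner_le_norm _ _)
  rw [norm_sub_rev w u] at h5
  have h6 : θ * (‖g u‖ * ‖u - w‖) ≤ B * ((4 * L * B ^ 3 * r) * ‖u - w‖) := by
    have := h.norm_le hr hB hL hxs hcrit hu
    gcongr
  nlinarith

/-- As `θ - 1` is at most of the order of the distance, it can be absorbed into the quadratic
term. -/
theorem abs_sub_linearization_le (h : LinearizationBounds r B L f g) (hr : 0 < r) (hB : 1 ≤ B)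
    (hL : 0 < L) (hxs : ‖xs‖ ≤ r) (hcrit : ∀ v, ⟪g xs, v⟫ = 0) {u w : Euc d} (hu : ‖u‖ ≤ r)
    (hw : ‖w‖ ≤ r) :
    |f w - f u - ⟪g u, w - u⟫| ≤ (4 * B ^ 4 * r + B ^ 2 / 2) * L * ‖w - u‖ ^ 2 := by
  obtain ⟨θ, h1, h2, h3, h4, h5⟩ := h u w hu hw
  have h6 : |(θ - 1) * ⟪g u, w - u⟫| ≤ (B * ‖w - u‖) * ((4 * L * B ^ 3 * r) * ‖w - u‖) := by
    rw [abs_mul]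
    refine mul_le_mul h3 ((abs_real_inner_le_norm _ _).trans ?_) (abs_nonneg _) (by positivity)
    have := h.norm_le hr hB hL hxs hcrit hu
    gcongr
  have h7 := abs_le.mp h6
  rw [abs_le]
  have h8 : 0 ≤ L * (B * ‖w - u‖) ^ 2 := by positivity
  constructor <;> linarith

end LinearizationBounds

/-- Two-sided quadratic estimates by linearizations make the gradient Lipschitz, up to the boundary
of the ball. Both gradients are tested on a ball whose size is comparable to `‖x - y‖`, which lies
in the given ball and near `y`. -/
theorem norm_sub_le_of_abs_sub_linearization_le {M : ℝ} (hM : 0 ≤ M) (hr : 0 < r)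
    (h : ∀ u w : Euc d, ‖u‖ ≤ r → ‖w‖ ≤ r → |f w - f u - ⟪g u, w - u⟫| ≤ M * ‖w - u‖ ^ 2)
    {x y : Euc d} (hx : ‖x‖ ≤ r) (hy : ‖y‖ ≤ r) : ‖g x - g y‖ ≤ 12 * M * ‖x - y‖ := by
  set ρ := ‖x - y‖ / 2 with hρ
  have hρ0 : 0 ≤ ρ := by positivity
  have hρr : ρ ≤ r := by
    have := norm_sub_le x y
    linarith
  rcases hρ0.eq_or_lt with h0 | h0
  · have : x - y = 0 := norm_eq_zero.mp (by linarith)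
    rw [sub_eq_zero.mp this]; simp
  rcases eq_or_ne (g x - g y) 0 with hg | hg
  · rw [hg, norm_zero]; positivity
  have hgp : 0 < ‖g x - g y‖ := norm_pos_iff.mpr hg
  have hq : 0 ≤ 1 - ρ / r := by rw [sub_nonneg, div_le_one hr]; exact hρr
  have key : ∀ p : Euc d, ‖p‖ ≤ ρ →
      |⟪g x - g y, (1 - ρ / r) • y + p - y⟫| ≤ 24 * M * ρ ^ 2 := by
    intro p hp
    set w := (1 - ρ / r) • y + p with hw
    have hwr : ‖w‖ ≤ r := by
      refine (norm_add_le _ _).trans ?_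
      rw [norm_smul, Real.norm_of_nonneg hq]
      have h1 : (1 - ρ / r) * ‖y‖ ≤ (1 - ρ / r) * r := by gcongr
      have h2 : (1 - ρ / r) * r = r - ρ := by field_simp
      linarith
    have hwy : ‖w - y‖ ≤ 2 * ρ := by
      have h1 : w - y = p - (ρ / r) • y := by rw [hw]; module
      rw [h1]
      refine (norm_sub_le _ _).trans ?_
      rw [norm_smul, Real.norm_of_nonneg (by positivity)]
      have h2 : ρ / r * ‖y‖ ≤ ρ / r * r := by gcongr
      rw [div_mul_cancel₀ _ hr.ne'] at h2
      linarith
    have hwx : ‖w - x‖ ≤ 4 * ρ := by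
      have h1 : w - x = (w - y) - (x - y) := by abel
      rw [h1]
      exact (norm_sub_le _ _).trans (by linarith)
    have h1 := h x w hx hwr
    have h2 := h y w hy hwr
    have h3 := h x y hx hy
    have h4 : ⟪g x - g y, w - y⟫ = -(f w - f x - ⟪g x, w - x⟫) + (f w - f y - ⟪g y, w - y⟫)
        + (f y - f x - ⟪g x, y - x⟫) := by
      simp only [inner_sub_left, inner_sub_right]; ring
    have h5 : M * ‖w - x‖ ^ 2 ≤ M * (4 * ρ) ^ 2 := by gcongr
    have h6 : M * ‖w - y‖ ^ 2 ≤ M * (2 * ρ) ^ 2 := by gcongr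
    have h7 : M * ‖y - x‖ ^ 2 = M * (2 * ρ) ^ 2 := by rw [norm_sub_rev, hρ]; ring
    rw [h4]
    rw [abs_le] at *
    constructor <;> linarith
  have hp : ‖(ρ / ‖g x - g y‖) • (g x - g y)‖ = ρ := by
    rw [norm_smul, Real.norm_of_nonneg (by positivity), div_mul_cancel₀ _ hgp.ne']
  have h1 := (abs_le.mp (key _ hp.le)).2
  have h2 := (abs_le.mp (key (-((ρ / ‖g x - g y‖) • (g x - g y))) (by rw [norm_neg, hp]))).1
  have h3 : ⟪g x - g y, (ρ / ‖g x - g y‖) • (g x - g y)⟫ = ρ * ‖g x - g y‖ := by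
    rw [real_inner_smul_right, real_inner_self_eq_norm_sq]; field_simp
  rw [inner_sub_right, inner_add_right, h3] at h1
  rw [inner_sub_right, inner_add_right, inner_neg_right, h3] at h2
  have h4 : ρ * ‖g x - g y‖ ≤ ρ * (24 * M * ρ) := by linarith
  have h5 := le_of_mul_le_mul_left h4 h0
  rw [hρ] at h5
  linarith

end Linearization

/-! ### The number of iterations and of queries -/

/-- With `t` of the order of `√y`, where `y = L / ε`, the number of bisections that are needed is
`O(log (2 + y))`, and the number of queries is `O(√y log (2 + y))`. -/
theorem exists_query_bound {a b y₀ : ℝ} (ha : 0 ≤ a) (hb : 0 ≤ b) (hy₀ : 0 < y₀) :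
    ∃ C : ℝ, 0 < C ∧ ∀ y : ℝ, y₀ ≤ y →
      ∃ N : ℕ, b * y * ((⌈a * Real.sqrt y⌉₊ + 2 : ℕ) : ℝ) ^ 2 ≤ 2 ^ N ∧
        (((⌈a * Real.sqrt y⌉₊ + 2) * (3 * N + 8) : ℕ) : ℝ)
          ≤ C * Real.sqrt y * Real.log (2 + y) := by
  have hlog2 : 0 < Real.log 2 := Real.log_pos one_lt_two
  have hs₀ : 0 < Real.sqrt y₀ := Real.sqrt_pos.mpr hy₀
  set m := a + 3 / Real.sqrt y₀ with hm
  have hm0 : 0 < m := by positivity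
  set c := 1 + b * m ^ 2 with hc
  have hc1 : 1 ≤ c := by
    have : 0 ≤ b * m ^ 2 := by positivity
    linarith
  have hlogc : 0 ≤ Real.log c := Real.log_nonneg hc1
  refine ⟨m * ((3 * (Real.log c / Real.log 2) + 17) / Real.log 2), by positivity,
    fun y hy => ?_⟩
  have hy0 : 0 < y := hy₀.trans_le hy
  have hsy : Real.sqrt y₀ ≤ Real.sqrt y := Real.sqrt_le_sqrt hy
  set t : ℕ := ⌈a * Real.sqrt y⌉₊ + 2 with ht
  have htle : (t : ℝ) ≤ m * Real.sqrt y := by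
    have h1 := (Nat.ceil_lt_add_one (a := a * Real.sqrt y) (by positivity)).le
    have h2 : 3 ≤ 3 / Real.sqrt y₀ * Real.sqrt y := by
      rw [div_mul_eq_mul_div, le_div_iff₀ hs₀]; linarith
    rw [ht, hm]; push_cast; linarith
  have hX : 0 < c * (2 + y) ^ 2 := by positivity
  set N := ⌈Real.log (c * (2 + y) ^ 2) / Real.log 2⌉₊ with hN
  have hlogX : Real.log (c * (2 + y) ^ 2) = Real.log c + 2 * Real.log (2 + y) := by
    rw [Real.log_mul (by positivity) (by positivity), Real.log_pow]; norm_num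
  have hlogy : Real.log 2 ≤ Real.log (2 + y) := Real.log_le_log two_pos (by linarith)
  refine ⟨N, ?_, ?_⟩
  · have h1 : Real.log (c * (2 + y) ^ 2) ≤ N * Real.log 2 := by
      rw [← div_le_iff₀ hlog2]; exact Nat.le_ceil _
    have h2 : c * (2 + y) ^ 2 ≤ 2 ^ N := by
      rw [← Real.log_pow] at h1
      exact (Real.log_le_log_iff hX (by positivity)).mp h1
    refine le_trans ?_ h2
    calc b * y * (t : ℝ) ^ 2 ≤ b * y * (m * Real.sqrt y) ^ 2 := by gcongr
      _ = b * m ^ 2 * y ^ 2 := by rw [mul_pow, Real.sq_sqrt hy0.le]; ring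
      _ ≤ c * (2 + y) ^ 2 := by gcongr <;> linarith
  · have h1 : (N : ℝ) ≤ Real.log (c * (2 + y) ^ 2) / Real.log 2 + 1 :=
      (Nat.ceil_lt_add_one (div_nonneg (by rw [hlogX]; linarith) hlog2.le)).le
    set v := Real.log (2 + y) / Real.log 2 with hv
    have hv1 : 1 ≤ v := (one_le_div hlog2).mpr hlogy
    have h2 : Real.log (c * (2 + y) ^ 2) / Real.log 2 = Real.log c / Real.log 2 + 2 * v := by
      rw [hlogX, hv]; ring
    have h3 : 0 ≤ Real.log c / Real.log 2 := by positivity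
    have h4 : 3 * (N : ℝ) + 8 ≤ (3 * (Real.log c / Real.log 2) + 17) * v := by
      rw [h2] at h1
      nlinarith
    push_cast
    calc (t : ℝ) * (3 * (N : ℝ) + 8)
        ≤ (m * Real.sqrt y) * ((3 * (Real.log c / Real.log 2) + 17) * v) := by gcongr
      _ = _ := by rw [hv]; ring

end GConvexAcceleration

open GConvexAcceleration
theorem mainTheorem1 (K R : ℝ) (hK : K ≠ 0) (hR : 0 ≤ R)
    (hKR : 0 < K → R < Real.pi / (2 * Real.sqrt K)) :
    ∃ γn ∈ Set.Ioc (0 : ℝ) 1, ∃ γp ∈ Set.Ioc (0 : ℝ) 1, ∃ c : ℝ, 0 < c ∧ ∃ C : ℝ, 0 < C ∧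
      ∃ T : ℝ → ℝ → ℕ,
        ∀ (d : ℕ) (x₀ : Amb d), x₀ ∈ modelSpace K d →
        ∀ e : Euc d →ₗ[ℝ] Amb d, IsFrame K x₀ e →
        ∀ (F : Amb d → ℝ) (L ε ρ : ℝ), 0 < L → 0 < ε → R < ρ →
          (∀ p ∈ openGeodBall K x₀ ρ, RiemDifferentiableAt K F p) →
          SmoothOn K L F (closedGeodBall K x₀ R) →
          GConvexOn K F (closedGeodBall K x₀ R) →
          ∀ xs ∈ closedGeodBall K x₀ R, riemGrad K F xs = 0 →
            ∃ (u : Euc d) (q : ℕ),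
              Returns (inputFor K R x₀ e F γn γp (c * L) ε (T L ε)) u q ∧
              geodInv K x₀ e u ∈ closedGeodBall K x₀ R ∧
              F (geodInv K x₀ e u) - F xs ≤ ε ∧
              (q : ℝ) ≤ C * Real.sqrt (L / ε) * Real.log (2 + L / ε) := by
  obtain ⟨B, hB, hbounds⟩ := exists_linearization_bounds hK hR hKR
  have hB0 : 0 < B := by linarith
  set r := ballRadius K R with hr
  have hr0 : 0 ≤ r := ballRadius_nonneg hR hKR
  set c := 12 * (4 * B ^ 4 * r + B ^ 2 / 2) with hc
  have hc0 : 0 < c := by positivity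
  -- `a √(L / ε)` iterations make `A_t ε ≥ r²`
  set a := 1 + 4 * c * r ^ 2 * B ^ 3 with ha
  have ha1 : 1 ≤ a := by
    have : 0 ≤ 4 * c * r ^ 2 * B ^ 3 := by positivity
    linarith
  set b := 16 * B ^ 4 * r ^ 2 with hb
  have hb0 : 0 ≤ b := by positivity
  obtain ⟨C, hC, hquery⟩ := exists_query_bound (a := a) (b := b)
    (y₀ := (1 + B ^ 2 * r ^ 2 / 2)⁻¹) (by linarith) hb0 (by positivity)
  have hγ : B⁻¹ ∈ Set.Ioc (0 : ℝ) 1 := ⟨by positivity, inv_le_one_of_one_le₀ hB⟩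
  classical
  refine ⟨B⁻¹, hγ, B⁻¹, hγ, c, hc0, C, hC,
    fun L ε => if L / 2 * (B * r) ^ 2 ≤ ε then 0 else ⌈a * Real.sqrt (L / ε)⌉₊ + 2,
    fun d x₀ hx₀ e he F L ε ρ hL hε hRρ hF hs hconv xs hxs hcrit => ?_⟩
  have hF' : ∀ p ∈ closedGeodBall K x₀ R, RiemDifferentiableAt K F p := by
    rintro p ⟨v, hv, hvR, hp⟩
    exact hF p ⟨v, hv, hvR.trans_lt hRρ, hp⟩
  have hlin : LinearizationBounds r B L (fun u => F (geodInv K x₀ e u))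
      (gradient fun u => F (geodInv K x₀ e u)) :=
    hbounds d x₀ hx₀ e he F L hL hF' hs hconv
  obtain ⟨us, hus, rfl⟩ := exists_geodInv_eq hK hKR hx₀ he hxs
  have hcrit' : ∀ v, ⟪gradient (fun u => F (geodInv K x₀ e u)) us, v⟫ = 0 := by
    intro v
    rw [inner_gradient_comp_geodInv hK hR hKR hx₀ he hus (hF' _ hxs), hcrit]
    simp [form]
  have hlog : 0 ≤ Real.log (2 + L / ε) := Real.log_nonneg (by
    have : 0 < L / ε := by positivity
    linarith)
  simp only
  split_ifs with hsmall
  · -- smoothness at the minimizer alone makes the starting point good enough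
    have h0 : ‖(0 : Euc d)‖ ≤ r := by rwa [norm_zero]
    refine ⟨0, 0, ⟨0, .init⟩, geodInv_mem_closedGeodBall hK hR hKR hx₀ he h0, ?_, ?_⟩
    · refine (hlin.sub_le_of_critical hus hcrit' h0).trans (le_trans ?_ hsmall)
      rw [zero_sub, norm_neg]
      gcongr
    · rw [Nat.cast_zero]; positivity
  · rw [not_le] at hsmall
    have hrpos : 0 < r := by
      refine hr0.lt_of_ne fun h => ?_
      rw [← h, mul_zero] at hsmall
      norm_num at hsmall
      linarith
    have hy : (1 + B ^ 2 * r ^ 2 / 2)⁻¹ ≤ L / ε := by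
      rw [inv_le_iff_one_le_mul₀ (by positivity), div_mul_eq_mul_div, le_div_iff₀ hε]
      nlinarith
    obtain ⟨N, hN, hq⟩ := hquery _ hy
    set t := ⌈a * Real.sqrt (L / ε)⌉₊ + 2 with ht
    set P := inputFor K R x₀ e F B⁻¹ B⁻¹ (c * L) ε t with hP
    have hquad : ∀ u w : Euc d, ‖u‖ ≤ r → ‖w‖ ≤ r → _ := fun u w hu hw =>
      hlin.abs_sub_linearization_le hrpos hB hL hus hcrit' hu hw
    have H : TiltedConvex P (4 * B ^ 4 * r * L) us :=
      { radius_nonneg := hr0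
        γn_pos := hγ.1
        γn_le := hγ.2
        γp_pos := hγ.1
        γp_le := hγ.2
        Lt_pos := mul_pos hc0 hL
        ε_pos := hε
        tilted := fun x y hx hy => by
          obtain ⟨θ, h1, h2, -, h4, -⟩ := hlin x y hx hy
          refine ⟨θ, ?_, ?_, h4⟩
          · exact (inv_le_iff_one_le_mul₀' hB0).mpr h1
          · change θ ≤ 1 / B⁻¹
            rwa [one_div, inv_inv]
        grad_lipschitz := fun x y hx hy => by
          refine (norm_sub_le_of_abs_sub_linearization_le (by positivity) hrpos hquad hx hy).trans
            (le_of_eq ?_)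
          change _ = (c * L) * _
          rw [hc]; ring
        val_lipschitz := fun x y hx hy => hlin.sub_le hrpos hB hL hus hcrit' hx hy
        minimizer_mem := hus
        minimizer_le := fun x hx => hlin.le_of_critical hus hcrit' hx }
    have ht2 : 2 ≤ t := by omega
    have ht2' : (2 : ℝ) ≤ t := by exact_mod_cast ht2
    have hta : a * Real.sqrt (L / ε) ≤ t := by
      rw [ht]; push_cast
      linarith [Nat.le_ceil (a * Real.sqrt (L / ε))]
    have hyε : L / ε * ε = L := div_mul_cancel₀ _ hε.ne'
    obtain ⟨u, q, hret, hu, hval, hqle⟩ := H.exists_returns (by positivity) ht2 N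
      (by
        change 4 * B ^ 4 * r * L * (2 * r * (1 + (t : ℝ))) ≤ 2 ^ N * (ε / (2 * ((t : ℝ) - 1)))
        rw [← mul_div_assoc, le_div_iff₀ (by linarith)]
        calc _ = b * (L / ε) * ((t : ℝ) ^ 2 - 1) * ε := by
              rw [hb]; field_simp; ring
          _ ≤ 2 ^ N * ε := by
              gcongr
              refine le_trans ?_ hN
              gcongr
              linarith)
      (by
        change r ^ 2 ≤ accRate P t * ε
        rw [accRate_eq]
        change r ^ 2 ≤ (t : ℝ) * (t + 1) * B⁻¹ ^ 2 * B⁻¹ / (4 * (c * L)) * ε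
        have h1 : a * (L / ε) ≤ (t : ℝ) * (t + 1) := by
          have h2 : (a * Real.sqrt (L / ε)) ^ 2 ≤ (t : ℝ) ^ 2 := by gcongr
          rw [mul_pow, Real.sq_sqrt (by positivity)] at h2
          have h3 : a * (L / ε) ≤ a ^ 2 * (L / ε) := by
            gcongr
            nlinarith
          nlinarith
        have h4 : r ^ 2 ≤ a * (L / ε) * B⁻¹ ^ 2 * B⁻¹ / (4 * (c * L)) * ε := by
          have : a * (L / ε) * B⁻¹ ^ 2 * B⁻¹ / (4 * (c * L)) * ε = a / (4 * c * B ^ 3) := by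
            field_simp
          rw [this, le_div_iff₀ (by positivity), ha]
          linarith
        exact h4.trans (by gcongr))
    exact ⟨u, q, hret, geodInv_mem_closedGeodBall hK hR hKR hx₀ he hu, hval,
      le_trans (by exact_mod_cast hqle) hq⟩
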